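/- Let $\Omega=\mathbb T\times[0,\pi]$ with $\mathbb T=\mathbb R/2\pi\mathbb Z$. Consider the inviscid Boussinesq equations in vorticity form on $\Omega$, $$\partial_t\rho+u\cdot\nabla\rho=0,\qquad \partial_t\omega+u\cdot\nabla\omega=-\partial_1\rho,\qquad u=\nabla^\perp(-\Delta)^{-1}\omega,$$ where $\nabla^\perp=(\partial_2,-\partial_1)$ and $(-\Delta)^{-1}$ is the inverse Laplacian on $\Omega$ with zero Dirichlet condition on $\{x_2=0\}$ and $\{x_2=\pi\}$ (so $\omega=\partial_1u_2-\partial_2u_1$, $\nabla\cdot u=0$, and $u_2=0$ on $\partial\Omega$). Let $\rho_0\in C^\infty(\Omega)$ be even in $x_1$ and $\omega_0\in C^\infty(\Omega)$ be odd in $x_1$ (smooth up to the boundary). Assume that there exists $k_0>0$ such that $\rho_0\ge k_0$ on $\{0\}\times[0,\pi]$, and that $\rho_0\le 0$ on $\{\pi\}\times[0,\pi]$. Then there exist constants $T_0=T_0(\rho_0,\omega_0)\ge 0$ and $c=c(\rho_0,\omega_0)>0$, with $T_0=0$ if $\int_{[0,\pi]\times[0,\pi]}\omega_0\,dx\ge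 0$, such that for every $T\in(0,\infty]$ and every smooth solution $(\rho,\omega)$ on $\Omega\times[0,T)$ with initial data $(\rho_0,\omega_0)$ (in particular for the maximal one, whose $T$ is the lifespan), $$\|\omega(t)\|_{L^p(\Omega)}\ge c\,t^{3-\frac2p}\quad\text{for all }p\in[1,\infty],\ t\in[T_0,T),$$ $$\|u(t)\|_{L^\infty(\Omega)}\ge c\,t\quad\text{for all }t\in[T_0,T),$$ $$\sup_{\tau\in[0,t]}\|\nabla\rho(\tau)\|_{L^\infty(\Omega)}>c\,t^2\quad\text{for all }t\in[0,T).$$ -/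

import Mathlib

noncomputable section

namespace BoussinesqStrip

/-! The strip is `Ω = 𝕋 × [0, π]` with `𝕋 = ℝ / 2πℤ`.  A function on `Ω` is represented by a
function `f : ℝ → ℝ → ℝ` of `(x₁, x₂)` that is `2π`-periodic in `x₁`; only its values for
`x₂ ∈ [0, π]` matter.  A time-dependent function on `Ω × [0, T)` is represented by a function
`ℝ → ℝ → ℝ → ℝ` of `(t, x₁, x₂)`; only its values for `t ∈ [0, T)`, `x₂ ∈ [0, π]` matter. -/

/-- `f` is `2π`-periodic in `x₁` on the strip. -/
def PeriodicX1 (f : ℝ → ℝ → ℝ) : Prop :=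
  ∀ x₁ : ℝ, ∀ x₂ ∈ Set.Icc 0 Real.pi, f (x₁ + 2 * Real.pi) x₂ = f x₁ x₂

/-- `f` is even in `x₁` on the strip. -/
def EvenX1 (f : ℝ → ℝ → ℝ) : Prop :=
  ∀ x₁ : ℝ, ∀ x₂ ∈ Set.Icc 0 Real.pi, f (-x₁) x₂ = f x₁ x₂

/-- `f` is odd in `x₁` on the strip. -/
def OddX1 (f : ℝ → ℝ → ℝ) : Prop :=
  ∀ x₁ : ℝ, ∀ x₂ ∈ Set.Icc 0 Real.pi, f (-x₁) x₂ = - f x₁ x₂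

/-- `f ∈ C^∞(𝕋 × [0, π])`: periodic in `x₁` and smooth up to the boundary. -/
structure SmoothOnStrip (f : ℝ → ℝ → ℝ) : Prop where
  smooth : ContDiffOn ℝ (⊤ : ℕ∞) (fun x : ℝ × ℝ => f x.1 x.2) (Set.univ ×ˢ Set.Icc 0 Real.pi)
  periodic : PeriodicX1 f

/-- The time interval `[0, T)`, where `T` may be `+∞`. -/
def timeInterval (T : EReal) : Set ℝ := {t : ℝ | 0 ≤ t ∧ (t : EReal) < T}

/-- `f ∈ C^∞(𝕋 × [0, π] × [0, T))`: smooth in space and time, up to the boundary and up to the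
initial time, and periodic in `x₁`. -/
structure SmoothOnSpacetime (T : EReal) (f : ℝ → ℝ → ℝ → ℝ) : Prop where
  smooth : ContDiffOn ℝ (⊤ : ℕ∞) (fun z : ℝ × ℝ × ℝ => f z.1 z.2.1 z.2.2)
    (timeInterval T ×ˢ Set.univ ×ˢ Set.Icc 0 Real.pi)
  periodic : ∀ t ∈ timeInterval T, PeriodicX1 (f t)

/-- The partial derivative `∂₁ f`. -/
def d1 (f : ℝ → ℝ → ℝ) (x₁ x₂ : ℝ) : ℝ := deriv (fun s => f s x₂) x₁

/-- The partial derivative `∂₂ f` (one-sided at `x₂ = 0` and `x₂ = π`). -/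
def d2 (f : ℝ → ℝ → ℝ) (x₁ x₂ : ℝ) : ℝ :=
  derivWithin (fun s => f x₁ s) (Set.Icc 0 Real.pi) x₂

/-- The time derivative `∂ₜ f` on `[0, T)` (one-sided at `t = 0`). -/
def dt (T : EReal) (f : ℝ → ℝ → ℝ → ℝ) (t x₁ x₂ : ℝ) : ℝ :=
  derivWithin (fun s => f s x₁ x₂) (timeInterval T) t

/-- `ψ = (-Δ)⁻¹ ω` on the strip, with zero Dirichlet condition on `x₂ = 0` and `x₂ = π`. -/
structure IsStreamFunction (ω ψ : ℝ → ℝ → ℝ) : Prop where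
  smooth : SmoothOnStrip ψ
  poisson : ∀ x₁ : ℝ, ∀ x₂ ∈ Set.Icc 0 Real.pi,
    -(d1 (d1 ψ) x₁ x₂ + d2 (d2 ψ) x₁ x₂) = ω x₁ x₂
  bottom : ∀ x₁ : ℝ, ψ x₁ 0 = 0
  top : ∀ x₁ : ℝ, ψ x₁ Real.pi = 0

/-- The Biot-Savart law `u = ∇^⊥ (-Δ)⁻¹ ω`, where `∇^⊥ = (∂₂, -∂₁)`, so that
`∂₁ u₂ - ∂₂ u₁ = ω`, `∇ · u = 0`, and `u₂ = 0` on `x₂ = 0` and `x₂ = π`. -/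
def BiotSavart (ω u₁ u₂ : ℝ → ℝ → ℝ) : Prop :=
  ∃ ψ : ℝ → ℝ → ℝ, IsStreamFunction ω ψ ∧
    ∀ x₁ : ℝ, ∀ x₂ ∈ Set.Icc 0 Real.pi, u₁ x₁ x₂ = d2 ψ x₁ x₂ ∧ u₂ x₁ x₂ = -d1 ψ x₁ x₂

/-- `(ρ, ω)`, with velocity `u = (u₁, u₂)`, is a smooth solution on `𝕋 × [0, π] × [0, T)` of the
inviscid Boussinesq equations in vorticity form with initial data `(ρ₀, ω₀)`. -/
structure IsSmoothSolution (T : EReal) (ρ₀ ω₀ : ℝ → ℝ → ℝ) (ρ ω u₁ u₂ : ℝ → ℝ → ℝ → ℝ) :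
    Prop where
  smooth_density : SmoothOnSpacetime T ρ
  smooth_vorticity : SmoothOnSpacetime T ω
  smooth_velocity₁ : SmoothOnSpacetime T u₁
  smooth_velocity₂ : SmoothOnSpacetime T u₂
  density_eq : ∀ t ∈ timeInterval T, ∀ x₁ : ℝ, ∀ x₂ ∈ Set.Icc 0 Real.pi,
    dt T ρ t x₁ x₂ + (u₁ t x₁ x₂ * d1 (ρ t) x₁ x₂ + u₂ t x₁ x₂ * d2 (ρ t) x₁ x₂) = 0
  vorticity_eq : ∀ t ∈ timeInterval T, ∀ x₁ : ℝ, ∀ x₂ ∈ Set.Icc 0 Real.pi,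
    dt T ω t x₁ x₂ + (u₁ t x₁ x₂ * d1 (ω t) x₁ x₂ + u₂ t x₁ x₂ * d2 (ω t) x₁ x₂)
      = -d1 (ρ t) x₁ x₂
  biot_savart : ∀ t ∈ timeInterval T, BiotSavart (ω t) (u₁ t) (u₂ t)
  initial_density : ∀ x₁ : ℝ, ∀ x₂ ∈ Set.Icc 0 Real.pi, ρ 0 x₁ x₂ = ρ₀ x₁ x₂
  initial_vorticity : ∀ x₁ : ℝ, ∀ x₂ ∈ Set.Icc 0 Real.pi, ω 0 x₁ x₂ = ω₀ x₁ x₂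

/-- The `L^p(Ω)` norm, computed on the fundamental domain `(-π, π] × [0, π]`. -/
def stripLpNorm (p : ENNReal) (f : ℝ → ℝ → ℝ) : ENNReal :=
  MeasureTheory.eLpNorm (fun x : ℝ × ℝ => f x.1 x.2) p
    (MeasureTheory.volume.restrict
      (Set.Ioc (-Real.pi) Real.pi ×ˢ Set.Icc 0 Real.pi))

/-- The pointwise Euclidean length `|v|` of a vector field `v = (v₁, v₂)`. -/
def vecLength (v₁ v₂ : ℝ → ℝ → ℝ) (x₁ x₂ : ℝ) : ℝ :=
  Real.sqrt (v₁ x₁ x₂ ^ 2 + v₂ x₁ x₂ ^ 2)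

end BoussinesqStrip

end

open Set MeasureTheory Filter Topology

namespace BoussinesqStrip

/-! ### Directional derivatives of smooth functions on a convex set -/

section Directional

variable {E : Type*} [NormedAddCommGroup E] [NormedSpace ℝ E] {D : Set E} {F : E → ℝ}

/-! The parity of the data confines the dynamics to the square `Q = [0, π]²`. The equations are
equivariant under `x₁ ↦ -x₁`, so uniqueness (`velocity_unique`) makes `u₁` odd. Hence `u₁ = 0` on
`x₁ = 0` and `x₁ = π`, and the flow is tangent to all four sides of `Q`. Density is transported
along the two axes, so `ρ ≥ k₀` on the first and `ρ ≤ 0` on the second for all time.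

Integrating the vorticity equation over `Q` removes the advection and leaves the density gap between
the axes: the circulation `∫_Q ω` grows at rate at least `k₀ π` (`rectInt_vorticity_ge`). Meanwhile
`∫_Q (|u|² + 2 x₂ ρ)` is conserved and `ρ` is bounded, so `u` stays bounded in `L²(Q)`
(`energy_le`).

These two facts give the growth. The circulation is a line integral of `u` over a perimeter `4π`, so
`‖u‖_∞` grows linearly (`ofReal_circulation_le`). For `L^p`, let `m` be a lower bound for the
circulation and cut off a layer of width `1 / c` along `∂Q`. Integration by parts bounds the
interior part of `∫ ω` by the `L²` norm of `u` times that of `∇φ`, which is of order `c^(1/2)`. With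
`c` of order `m²` this is at most `m / 2`, so the remaining `m / 2` sits in a layer of area of order
`m⁻²`. Hölder then gives `‖ω‖_p` of order `m^(3 - 2/p)` (`ofReal_half_circulation_le`).

Finally, `ω` is transported with source `-∂₁ρ`, so `|ω(t)| ≤ W + t sup |∂₁ρ|` on `Q`. Compared with
cubic growth of the sup norm of `ω`, this forces quadratic growth of `∇ρ`. At small times the gap
`k₀` across a distance `π` suffices.

No flow map or pressure is used: transport bounds come from a maximum principle, and energy
identities are written with the stream function. -/

theorem contDiffOn_dirDeriv (hD : UniqueDiffOn ℝ D) (hF : ContDiffOn ℝ (⊤ : ℕ∞) F D) (v : E) :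
    ContDiffOn ℝ (⊤ : ℕ∞) (fun z => fderivWithin ℝ F D z v) D :=
  (hF.fderivWithin hD (by simp)).clm_apply contDiffOn_const

/-- Symmetry of the second derivative persists up to the boundary because `D` lies in the closure of
its interior. Allowing `G` and `H` to agree with the derivatives only on `D` lets the one-sided
partials `d1`, `d2`, `dt` take their place. -/
theorem dirDeriv_comm (hD : UniqueDiffOn ℝ D) (hcl : D ⊆ closure (interior D))
    (hF : ContDiffOn ℝ (⊤ : ℕ∞) F D) (v w : E) {G H : E → ℝ}
    (hG : ∀ z ∈ D, G z = fderivWithin ℝ F D z v) (hH : ∀ z ∈ D, H z = fderivWithin ℝ F D z w)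
    {z : E} (hz : z ∈ D) :
    fderivWithin ℝ G D z w = fderivWithin ℝ H D z v := by
  have h1 : DifferentiableWithinAt ℝ (fderivWithin ℝ F D) D z :=
    ((hF.fderivWithin (m := (⊤ : ℕ∞)) hD (by simp)).differentiableOn (by simp)) z hz
  have key : ∀ a b : E, fderivWithin ℝ (fun z => fderivWithin ℝ F D z a) D z b
      = fderivWithin ℝ (fderivWithin ℝ F D) D z b a := by
    intro a b
    rw [fderivWithin_clm_apply (hD z hz) h1 (differentiableWithinAt_const a)]
    simp
  rw [fderivWithin_congr hG (hG z hz), fderivWithin_congr hH (hH z hz), key, key]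
  exact (hF z hz).isSymmSndFDerivWithinAt (by simpa using WithTop.coe_le_coe.2 (le_top : (2 : ℕ∞) ≤ ⊤))
    hD (hcl hz) hz w v

theorem hasDerivWithinAt_line (hF : ContDiffOn ℝ (⊤ : ℕ∞) F D) {γ : ℝ → E} {v : E} {J : Set ℝ}
    {a : ℝ} (hγ : HasDerivWithinAt γ v J a) (hJ : MapsTo γ J D) (ha : γ a ∈ D) :
    HasDerivWithinAt (fun s => F (γ s)) (fderivWithin ℝ F D (γ a) v) J a :=
  ((hF.differentiableOn (by simp)) _ ha).hasFDerivWithinAt.comp_hasDerivWithinAt a hγ hJ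

end Directional

/-! ### Calculus on the strip -/

/-- `f` is smooth on `ℝ × [0, π]` up to the boundary. -/
def Smooth2 (f : ℝ → ℝ → ℝ) : Prop :=
  ContDiffOn ℝ (⊤ : ℕ∞) (fun x : ℝ × ℝ => f x.1 x.2) (univ ×ˢ Icc 0 Real.pi)

/-- `f` is smooth on `[0, T) × ℝ × [0, π]` up to the boundary. -/
def Smooth3 (T : EReal) (f : ℝ → ℝ → ℝ → ℝ) : Prop :=
  ContDiffOn ℝ (⊤ : ℕ∞) (fun z : ℝ × ℝ × ℝ => f z.1 z.2.1 z.2.2)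
    (timeInterval T ×ˢ univ ×ˢ Icc 0 Real.pi)

theorem uniqueDiffOn_Icc_pi : UniqueDiffOn ℝ (Icc 0 Real.pi) := uniqueDiffOn_Icc Real.pi_pos

theorem closure_interior_of_convex {E : Type*} [NormedAddCommGroup E] [NormedSpace ℝ E] {D : Set E}
    (hD : Convex ℝ D) (hne : (interior D).Nonempty) : D ⊆ closure (interior D) := by
  rw [hD.closure_interior_eq_closure_of_nonempty_interior hne]
  exact subset_closure

theorem strip_nice : UniqueDiffOn ℝ ((univ : Set ℝ) ×ˢ Icc 0 Real.pi) ∧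
    (univ : Set ℝ) ×ˢ Icc 0 Real.pi ⊆ closure (interior ((univ : Set ℝ) ×ˢ Icc 0 Real.pi)) := by
  have hc : Convex ℝ ((univ : Set ℝ) ×ˢ Icc 0 Real.pi) := convex_univ.prod (convex_Icc _ _)
  have hne : (interior ((univ : Set ℝ) ×ˢ Icc 0 Real.pi)).Nonempty := by
    rw [interior_prod_eq, interior_univ, interior_Icc]
    exact univ_nonempty.prod (nonempty_Ioo.2 Real.pi_pos)
  exact ⟨uniqueDiffOn_convex hc hne, closure_interior_of_convex hc hne⟩

theorem convex_timeInterval (T : EReal) : Convex ℝ (timeInterval T) := by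
  refine Set.OrdConnected.convex ⟨fun a ha b hb c hc => ⟨ha.1.trans hc.1, ?_⟩⟩
  exact lt_of_le_of_lt (EReal.coe_le_coe_iff.2 hc.2) hb.2

theorem Icc_subset_timeInterval {T : EReal} {t : ℝ} (ht : t ∈ timeInterval T) :
    Icc 0 t ⊆ timeInterval T := fun _ hs =>
  ⟨hs.1, lt_of_le_of_lt (EReal.coe_le_coe_iff.2 hs.2) ht.2⟩

theorem zero_mem_timeInterval {T : EReal} (hT : 0 < T) : (0 : ℝ) ∈ timeInterval T :=
  ⟨le_rfl, by simpa using hT⟩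

theorem interior_timeInterval_nonempty {T : EReal} (hT : 0 < T) :
    (interior (timeInterval T)).Nonempty := by
  obtain ⟨r, hr, hrT⟩ := EReal.lt_iff_exists_real_btwn.1 hT
  have hr0 : 0 < r := by exact_mod_cast hr
  refine ⟨r / 2, mem_interior.2 ⟨Ioo 0 r, ?_, isOpen_Ioo, by constructor <;> linarith⟩⟩
  exact Ioo_subset_Icc_self.trans (Icc_subset_timeInterval ⟨hr0.le, hrT⟩)

theorem uniqueDiffOn_timeInterval {T : EReal} (hT : 0 < T) : UniqueDiffOn ℝ (timeInterval T) :=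
  uniqueDiffOn_convex (convex_timeInterval T) (interior_timeInterval_nonempty hT)

theorem spacetime_nice {T : EReal} (hT : 0 < T) :
    UniqueDiffOn ℝ (timeInterval T ×ˢ (univ : Set ℝ) ×ˢ Icc 0 Real.pi) ∧
    timeInterval T ×ˢ (univ : Set ℝ) ×ˢ Icc 0 Real.pi ⊆
      closure (interior (timeInterval T ×ˢ (univ : Set ℝ) ×ˢ Icc 0 Real.pi)) := by
  have hc : Convex ℝ (timeInterval T ×ˢ (univ : Set ℝ) ×ˢ Icc 0 Real.pi) :=
    (convex_timeInterval T).prod (convex_univ.prod (convex_Icc _ _))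
  have hne : (interior (timeInterval T ×ˢ (univ : Set ℝ) ×ˢ Icc 0 Real.pi)).Nonempty := by
    rw [interior_prod_eq, interior_prod_eq, interior_univ, interior_Icc]
    exact (interior_timeInterval_nonempty hT).prod
      (univ_nonempty.prod (nonempty_Ioo.2 Real.pi_pos))
  exact ⟨uniqueDiffOn_convex hc hne, closure_interior_of_convex hc hne⟩

/-! ### Partial derivatives of functions smooth up to the walls. -/

section TwoVariables

variable {f g : ℝ → ℝ → ℝ}

/-- Identifying one-variable derivatives with a Fréchet derivative along a fixed vector is what
yields smoothness of the partials and their commutation. -/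
theorem Smooth2.hasDerivAt_dir (hf : Smooth2 f) (x : ℝ) {y : ℝ} (hy : y ∈ Icc 0 Real.pi) :
    HasDerivAt (fun s => f s y)
      (fderivWithin ℝ (fun x : ℝ × ℝ => f x.1 x.2) (univ ×ˢ Icc 0 Real.pi) (x, y) (1, 0)) x :=
  hasDerivWithinAt_univ.1 <| hasDerivWithinAt_line (γ := fun s => (s, y)) hf
    ((hasDerivWithinAt_id x univ).prodMk (hasDerivWithinAt_const x univ y))
    (fun _ _ => ⟨mem_univ _, hy⟩) ⟨mem_univ _, hy⟩

theorem Smooth2.hasDerivWithinAt_dir (hf : Smooth2 f) (x : ℝ) {y : ℝ} (hy : y ∈ Icc 0 Real.pi) :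
    HasDerivWithinAt (fun s => f x s)
      (fderivWithin ℝ (fun x : ℝ × ℝ => f x.1 x.2) (univ ×ˢ Icc 0 Real.pi) (x, y) (0, 1))
      (Icc 0 Real.pi) y :=
  hasDerivWithinAt_line (γ := fun s => (x, s)) hf
    ((hasDerivWithinAt_const y _ x).prodMk (hasDerivWithinAt_id y _))
    (fun _ h => ⟨mem_univ _, h⟩) ⟨mem_univ _, hy⟩

theorem Smooth2.d1_eq (hf : Smooth2 f) (x : ℝ) {y : ℝ} (hy : y ∈ Icc 0 Real.pi) :
    d1 f x y =
      fderivWithin ℝ (fun x : ℝ × ℝ => f x.1 x.2) (univ ×ˢ Icc 0 Real.pi) (x, y) (1, 0) :=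
  (hf.hasDerivAt_dir x hy).deriv

theorem Smooth2.d2_eq (hf : Smooth2 f) (x : ℝ) {y : ℝ} (hy : y ∈ Icc 0 Real.pi) :
    d2 f x y =
      fderivWithin ℝ (fun x : ℝ × ℝ => f x.1 x.2) (univ ×ˢ Icc 0 Real.pi) (x, y) (0, 1) :=
  (hf.hasDerivWithinAt_dir x hy).derivWithin (uniqueDiffOn_Icc_pi y hy)

theorem Smooth2.hasDerivAt (hf : Smooth2 f) (x : ℝ) {y : ℝ} (hy : y ∈ Icc 0 Real.pi) :
    HasDerivAt (fun s => f s y) (d1 f x y) x := by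
  rw [hf.d1_eq x hy]; exact hf.hasDerivAt_dir x hy

theorem Smooth2.hasDerivWithinAt (hf : Smooth2 f) (x : ℝ) {y : ℝ} (hy : y ∈ Icc 0 Real.pi) :
    HasDerivWithinAt (fun s => f x s) (d2 f x y) (Icc 0 Real.pi) y := by
  rw [hf.d2_eq x hy]; exact hf.hasDerivWithinAt_dir x hy

theorem Smooth2.d1 (hf : Smooth2 f) : Smooth2 (d1 f) :=
  (contDiffOn_dirDeriv strip_nice.1 hf (1, 0)).congr fun z hz => hf.d1_eq z.1 hz.2

theorem Smooth2.d2 (hf : Smooth2 f) : Smooth2 (d2 f) :=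
  (contDiffOn_dirDeriv strip_nice.1 hf (0, 1)).congr fun z hz => hf.d2_eq z.1 hz.2

theorem d1_congr {y : ℝ} (h : ∀ x, f x y = g x y) (x : ℝ) : d1 f x y = d1 g x y := by
  unfold BoussinesqStrip.d1; simp only [h]

theorem d2_congr {x : ℝ} (h : ∀ y ∈ Icc 0 Real.pi, f x y = g x y) {y : ℝ}
    (hy : y ∈ Icc 0 Real.pi) : d2 f x y = d2 g x y :=
  derivWithin_congr h (h y hy)

theorem Smooth2.congr (hf : Smooth2 f) (h : ∀ x, ∀ y ∈ Icc 0 Real.pi, g x y = f x y) :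
    Smooth2 g :=
  ContDiffOn.congr hf fun z hz => h z.1 z.2 hz.2

theorem Smooth2.d1_d2_comm (hf : Smooth2 f) (x : ℝ) {y : ℝ} (hy : y ∈ Icc 0 Real.pi) :
    BoussinesqStrip.d1 (BoussinesqStrip.d2 f) x y
      = BoussinesqStrip.d2 (BoussinesqStrip.d1 f) x y := by
  have e1 := (hf.d2).d1_eq x hy
  have e2 := (hf.d1).d2_eq x hy
  rw [e1, e2]
  exact dirDeriv_comm strip_nice.1 strip_nice.2 hf _ _ (fun z hz => hf.d2_eq z.1 hz.2)
    (fun z hz => hf.d1_eq z.1 hz.2) ⟨mem_univ _, hy⟩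

theorem Smooth2.add (hf : Smooth2 f) (hg : Smooth2 g) : Smooth2 (f + g) := ContDiffOn.add hf hg
theorem Smooth2.sub (hf : Smooth2 f) (hg : Smooth2 g) : Smooth2 (f - g) := ContDiffOn.sub hf hg
theorem Smooth2.mul (hf : Smooth2 f) (hg : Smooth2 g) : Smooth2 (f * g) := ContDiffOn.mul hf hg
theorem Smooth2.neg (hf : Smooth2 f) : Smooth2 (-f) := ContDiffOn.neg hf
theorem smooth2_const (c : ℝ) : Smooth2 (fun _ _ => c) := contDiffOn_const
theorem smooth2_fst {φ : ℝ → ℝ} (hφ : ContDiff ℝ (⊤ : ℕ∞) φ) : Smooth2 (fun x _ => φ x) :=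
  (hφ.comp contDiff_fst).contDiffOn
theorem smooth2_snd {φ : ℝ → ℝ} (hφ : ContDiff ℝ (⊤ : ℕ∞) φ) : Smooth2 (fun _ y => φ y) :=
  (hφ.comp contDiff_snd).contDiffOn

theorem Smooth2.d1_add (hf : Smooth2 f) (hg : Smooth2 g) (x : ℝ) {y : ℝ}
    (hy : y ∈ Icc 0 Real.pi) :
    BoussinesqStrip.d1 (f + g) x y = BoussinesqStrip.d1 f x y + BoussinesqStrip.d1 g x y :=
  ((hf.hasDerivAt x hy).add (hg.hasDerivAt x hy)).deriv

theorem Smooth2.d1_sub (hf : Smooth2 f) (hg : Smooth2 g) (x : ℝ) {y : ℝ}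
    (hy : y ∈ Icc 0 Real.pi) :
    BoussinesqStrip.d1 (f - g) x y = BoussinesqStrip.d1 f x y - BoussinesqStrip.d1 g x y :=
  ((hf.hasDerivAt x hy).sub (hg.hasDerivAt x hy)).deriv

theorem Smooth2.d1_mul (hf : Smooth2 f) (hg : Smooth2 g) (x : ℝ) {y : ℝ}
    (hy : y ∈ Icc 0 Real.pi) :
    BoussinesqStrip.d1 (f * g) x y
      = BoussinesqStrip.d1 f x y * g x y + f x y * BoussinesqStrip.d1 g x y :=
  ((hf.hasDerivAt x hy).mul (hg.hasDerivAt x hy)).deriv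

theorem d1_neg (x y : ℝ) : d1 (-f) x y = -d1 f x y := deriv.fun_neg

theorem Smooth2.d2_sub (hf : Smooth2 f) (hg : Smooth2 g) (x : ℝ) {y : ℝ}
    (hy : y ∈ Icc 0 Real.pi) :
    BoussinesqStrip.d2 (f - g) x y = BoussinesqStrip.d2 f x y - BoussinesqStrip.d2 g x y :=
  ((hf.hasDerivWithinAt x hy).sub (hg.hasDerivWithinAt x hy)).derivWithin
    (uniqueDiffOn_Icc_pi y hy)

theorem Smooth2.d2_mul (hf : Smooth2 f) (hg : Smooth2 g) (x : ℝ) {y : ℝ}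
    (hy : y ∈ Icc 0 Real.pi) :
    BoussinesqStrip.d2 (f * g) x y
      = BoussinesqStrip.d2 f x y * g x y + f x y * BoussinesqStrip.d2 g x y :=
  ((hf.hasDerivWithinAt x hy).mul (hg.hasDerivWithinAt x hy)).derivWithin
    (uniqueDiffOn_Icc_pi y hy)

theorem d2_neg (x y : ℝ) : d2 (-f) x y = -d2 f x y := derivWithin.fun_neg

theorem d1_const_fun (φ : ℝ → ℝ) (x y : ℝ) : d1 (fun _ y => φ y) x y = 0 := deriv_const _ _

theorem d2_const_fun (φ : ℝ → ℝ) (x y : ℝ) : d2 (fun x _ => φ x) x y = 0 := by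
  simp [BoussinesqStrip.d2]

theorem d1_fun {φ : ℝ → ℝ} {φ' x : ℝ} (h : HasDerivAt φ φ' x) (y : ℝ) :
    d1 (fun x _ => φ x) x y = φ' := h.deriv

theorem d2_fun {φ : ℝ → ℝ} {φ' y : ℝ} (h : HasDerivAt φ φ' y) (hy : y ∈ Icc 0 Real.pi) (x : ℝ) :
    d2 (fun _ y => φ y) x y = φ' := h.hasDerivWithinAt.derivWithin (uniqueDiffOn_Icc_pi y hy)

end TwoVariables

/-! ### Partial derivatives of functions of time and space. -/

section ThreeVariables

variable {T : EReal} {f g : ℝ → ℝ → ℝ → ℝ}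

theorem Smooth3.slice (hf : Smooth3 T f) {t : ℝ} (ht : t ∈ timeInterval T) : Smooth2 (f t) :=
  ContDiffOn.comp (g := fun z : ℝ × ℝ × ℝ => f z.1 z.2.1 z.2.2) (f := fun x : ℝ × ℝ => (t, x)) hf
    (contDiff_const.prodMk contDiff_id).contDiffOn fun _ hx => ⟨ht, hx⟩

theorem Smooth3.hasDerivWithinAt_dir (hf : Smooth3 T f) {t : ℝ} (ht : t ∈ timeInterval T) (x : ℝ)
    {y : ℝ} (hy : y ∈ Icc 0 Real.pi) :
    HasDerivWithinAt (fun s => f s x y)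
      (fderivWithin ℝ (fun z : ℝ × ℝ × ℝ => f z.1 z.2.1 z.2.2)
        (timeInterval T ×ˢ univ ×ˢ Icc 0 Real.pi) (t, x, y) (1, 0, 0)) (timeInterval T) t :=
  hasDerivWithinAt_line (γ := fun s => (s, x, y)) hf
    ((hasDerivWithinAt_id t _).prodMk (hasDerivWithinAt_const t _ (x, y)))
    (fun _ h => ⟨h, mem_univ _, hy⟩) ⟨ht, mem_univ _, hy⟩

theorem Smooth3.dt_eq (hT : 0 < T) (hf : Smooth3 T f) {t : ℝ} (ht : t ∈ timeInterval T) (x : ℝ)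
    {y : ℝ} (hy : y ∈ Icc 0 Real.pi) :
    dt T f t x y = fderivWithin ℝ (fun z : ℝ × ℝ × ℝ => f z.1 z.2.1 z.2.2)
        (timeInterval T ×ˢ univ ×ˢ Icc 0 Real.pi) (t, x, y) (1, 0, 0) :=
  (hf.hasDerivWithinAt_dir ht x hy).derivWithin (uniqueDiffOn_timeInterval hT t ht)

theorem Smooth3.hasDerivWithinAt (hT : 0 < T) (hf : Smooth3 T f) {t : ℝ} (ht : t ∈ timeInterval T)
    (x : ℝ) {y : ℝ} (hy : y ∈ Icc 0 Real.pi) :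
    HasDerivWithinAt (fun s => f s x y) (dt T f t x y) (timeInterval T) t := by
  rw [hf.dt_eq hT ht x hy]; exact hf.hasDerivWithinAt_dir ht x hy

theorem Smooth3.d1_eq (hf : Smooth3 T f) {t : ℝ} (ht : t ∈ timeInterval T) (x : ℝ)
    {y : ℝ} (hy : y ∈ Icc 0 Real.pi) :
    BoussinesqStrip.d1 (f t) x y = fderivWithin ℝ (fun z : ℝ × ℝ × ℝ => f z.1 z.2.1 z.2.2)
        (timeInterval T ×ˢ univ ×ˢ Icc 0 Real.pi) (t, x, y) (0, 1, 0) :=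
  (hasDerivWithinAt_univ.1 <| hasDerivWithinAt_line (γ := fun s => (t, s, y)) hf
    ((hasDerivWithinAt_const x univ t).prodMk
      ((hasDerivWithinAt_id x univ).prodMk (hasDerivWithinAt_const x univ y)))
    (fun _ _ => ⟨ht, mem_univ _, hy⟩) ⟨ht, mem_univ _, hy⟩).deriv

theorem Smooth3.d2_eq (hf : Smooth3 T f) {t : ℝ} (ht : t ∈ timeInterval T) (x : ℝ)
    {y : ℝ} (hy : y ∈ Icc 0 Real.pi) :
    BoussinesqStrip.d2 (f t) x y = fderivWithin ℝ (fun z : ℝ × ℝ × ℝ => f z.1 z.2.1 z.2.2)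
        (timeInterval T ×ˢ univ ×ˢ Icc 0 Real.pi) (t, x, y) (0, 0, 1) :=
  (hasDerivWithinAt_line (γ := fun s => (t, x, s)) hf
    ((hasDerivWithinAt_const y _ t).prodMk
      ((hasDerivWithinAt_const y _ x).prodMk (hasDerivWithinAt_id y _)))
    (fun _ h => ⟨ht, mem_univ _, h⟩) ⟨ht, mem_univ _, hy⟩).derivWithin (uniqueDiffOn_Icc_pi y hy)

theorem Smooth3.dt (hT : 0 < T) (hf : Smooth3 T f) : Smooth3 T (dt T f) :=
  (contDiffOn_dirDeriv (spacetime_nice hT).1 hf (1, 0, 0)).congr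
    fun z hz => hf.dt_eq hT hz.1 z.2.1 hz.2.2

theorem Smooth3.d1 (hT : 0 < T) (hf : Smooth3 T f) :
    Smooth3 T (fun t => BoussinesqStrip.d1 (f t)) :=
  (contDiffOn_dirDeriv (spacetime_nice hT).1 hf (0, 1, 0)).congr
    fun z hz => hf.d1_eq hz.1 z.2.1 hz.2.2

theorem Smooth3.d2 (hT : 0 < T) (hf : Smooth3 T f) :
    Smooth3 T (fun t => BoussinesqStrip.d2 (f t)) :=
  (contDiffOn_dirDeriv (spacetime_nice hT).1 hf (0, 0, 1)).congr
    fun z hz => hf.d2_eq hz.1 z.2.1 hz.2.2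

theorem Smooth3.dt_d1_comm (hT : 0 < T) (hf : Smooth3 T f) {t : ℝ} (ht : t ∈ timeInterval T)
    (x : ℝ) {y : ℝ} (hy : y ∈ Icc 0 Real.pi) :
    BoussinesqStrip.dt T (fun t => BoussinesqStrip.d1 (f t)) t x y
      = BoussinesqStrip.d1 (BoussinesqStrip.dt T f t) x y := by
  have e1 := (hf.d1 hT).dt_eq hT ht x hy
  have e2 := (hf.dt hT).d1_eq ht x hy
  rw [e1, e2]
  exact dirDeriv_comm (spacetime_nice hT).1 (spacetime_nice hT).2 hf _ _
    (fun z hz => hf.d1_eq hz.1 z.2.1 hz.2.2) (fun z hz => hf.dt_eq hT hz.1 z.2.1 hz.2.2)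
    ⟨ht, mem_univ _, hy⟩

theorem Smooth3.dt_d2_comm (hT : 0 < T) (hf : Smooth3 T f) {t : ℝ} (ht : t ∈ timeInterval T)
    (x : ℝ) {y : ℝ} (hy : y ∈ Icc 0 Real.pi) :
    BoussinesqStrip.dt T (fun t => BoussinesqStrip.d2 (f t)) t x y
      = BoussinesqStrip.d2 (BoussinesqStrip.dt T f t) x y := by
  have e1 := (hf.d2 hT).dt_eq hT ht x hy
  have e2 := (hf.dt hT).d2_eq ht x hy
  rw [e1, e2]
  exact dirDeriv_comm (spacetime_nice hT).1 (spacetime_nice hT).2 hf _ _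
    (fun z hz => hf.d2_eq hz.1 z.2.1 hz.2.2) (fun z hz => hf.dt_eq hT hz.1 z.2.1 hz.2.2)
    ⟨ht, mem_univ _, hy⟩

theorem Smooth3.congr (hf : Smooth3 T f)
    (h : ∀ t ∈ timeInterval T, ∀ x, ∀ y ∈ Icc 0 Real.pi, g t x y = f t x y) : Smooth3 T g :=
  ContDiffOn.congr hf fun z hz => h z.1 hz.1 z.2.1 z.2.2 hz.2.2

theorem Smooth3.add (hf : Smooth3 T f) (hg : Smooth3 T g) : Smooth3 T (f + g) :=
  ContDiffOn.add hf hg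
theorem Smooth3.sub (hf : Smooth3 T f) (hg : Smooth3 T g) : Smooth3 T (f - g) :=
  ContDiffOn.sub hf hg
theorem Smooth3.mul (hf : Smooth3 T f) (hg : Smooth3 T g) : Smooth3 T (f * g) :=
  ContDiffOn.mul hf hg
theorem smooth3_time {φ : ℝ → ℝ} (hφ : ContDiff ℝ (⊤ : ℕ∞) φ) : Smooth3 T (fun t _ _ => φ t) :=
  (hφ.comp contDiff_fst).contDiffOn
theorem smooth3_snd {φ : ℝ → ℝ} (hφ : ContDiff ℝ (⊤ : ℕ∞) φ) : Smooth3 T (fun _ _ y => φ y) :=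
  (hφ.comp (contDiff_snd.comp contDiff_snd)).contDiffOn

theorem Smooth3.dt_add (hT : 0 < T) (hf : Smooth3 T f) (hg : Smooth3 T g) {t : ℝ}
    (ht : t ∈ timeInterval T) (x : ℝ) {y : ℝ} (hy : y ∈ Icc 0 Real.pi) :
    BoussinesqStrip.dt T (f + g) t x y
      = BoussinesqStrip.dt T f t x y + BoussinesqStrip.dt T g t x y :=
  ((hf.hasDerivWithinAt hT ht x hy).add (hg.hasDerivWithinAt hT ht x hy)).derivWithin
    (uniqueDiffOn_timeInterval hT t ht)

theorem Smooth3.dt_sub (hT : 0 < T) (hf : Smooth3 T f) (hg : Smooth3 T g) {t : ℝ}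
    (ht : t ∈ timeInterval T) (x : ℝ) {y : ℝ} (hy : y ∈ Icc 0 Real.pi) :
    BoussinesqStrip.dt T (f - g) t x y
      = BoussinesqStrip.dt T f t x y - BoussinesqStrip.dt T g t x y :=
  ((hf.hasDerivWithinAt hT ht x hy).sub (hg.hasDerivWithinAt hT ht x hy)).derivWithin
    (uniqueDiffOn_timeInterval hT t ht)

theorem Smooth3.dt_mul (hT : 0 < T) (hf : Smooth3 T f) (hg : Smooth3 T g) {t : ℝ}
    (ht : t ∈ timeInterval T) (x : ℝ) {y : ℝ} (hy : y ∈ Icc 0 Real.pi) :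
    BoussinesqStrip.dt T (f * g) t x y
      = BoussinesqStrip.dt T f t x y * g t x y + f t x y * BoussinesqStrip.dt T g t x y :=
  ((hf.hasDerivWithinAt hT ht x hy).mul (hg.hasDerivWithinAt hT ht x hy)).derivWithin
    (uniqueDiffOn_timeInterval hT t ht)

theorem dt_time (hT : 0 < T) {φ : ℝ → ℝ} {φ' t : ℝ} (h : HasDerivAt φ φ' t)
    (ht : t ∈ timeInterval T) (x y : ℝ) :
    dt T (fun t _ _ => φ t) t x y = φ' :=
  h.hasDerivWithinAt.derivWithin (uniqueDiffOn_timeInterval hT t ht)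

theorem dt_snd (φ : ℝ → ℝ) (t x y : ℝ) : dt T (fun _ _ y => φ y) t x y = 0 := by
  simp [BoussinesqStrip.dt]

theorem dt_congr (h : ∀ t ∈ timeInterval T, ∀ x, ∀ y ∈ Icc 0 Real.pi, f t x y = g t x y) {t : ℝ}
    (ht : t ∈ timeInterval T) (x : ℝ) {y : ℝ} (hy : y ∈ Icc 0 Real.pi) :
    BoussinesqStrip.dt T f t x y = BoussinesqStrip.dt T g t x y :=
  derivWithin_congr (fun s hs => h s hs x y hy) (h t ht x y hy)

end ThreeVariables

end BoussinesqStrip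

namespace BoussinesqStrip

/-! ### Integration over rectangles `[a, b] × [0, π]` -/

/-- The rectangle `[a, b] × [0, π]`. -/
def rect (a b : ℝ) : Set (ℝ × ℝ) := Icc a b ×ˢ Icc 0 Real.pi

/-- The integral over `[a, b] × [0, π]`. -/
noncomputable def rectInt (a b : ℝ) (f : ℝ → ℝ → ℝ) : ℝ := ∫ z in rect a b, f z.1 z.2

variable {a b : ℝ} {f g F G : ℝ → ℝ → ℝ}

theorem isCompact_rect (a b : ℝ) : IsCompact (rect a b) := isCompact_Icc.prod isCompact_Icc

theorem measurableSet_rect (a b : ℝ) : MeasurableSet (rect a b) :=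
  measurableSet_Icc.prod measurableSet_Icc

theorem Smooth2.continuousOn_rect (hf : Smooth2 f) (a b : ℝ) :
    ContinuousOn (fun z : ℝ × ℝ => f z.1 z.2) (rect a b) :=
  (ContDiffOn.continuousOn hf).mono (prod_mono (subset_univ _) subset_rfl)

theorem Smooth2.integrableOn (hf : Smooth2 f) (a b : ℝ) :
    IntegrableOn (fun z : ℝ × ℝ => f z.1 z.2) (rect a b) :=
  (hf.continuousOn_rect a b).integrableOn_compact (isCompact_rect a b)

theorem rectInt_congr (h : ∀ x ∈ Icc a b, ∀ y ∈ Icc 0 Real.pi, f x y = g x y) :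
    rectInt a b f = rectInt a b g :=
  setIntegral_congr_fun (measurableSet_rect a b) fun z hz => h z.1 hz.1 z.2 hz.2

theorem rectInt_mono (hf : Smooth2 f) (hg : Smooth2 g)
    (h : ∀ x ∈ Icc a b, ∀ y ∈ Icc 0 Real.pi, f x y ≤ g x y) : rectInt a b f ≤ rectInt a b g :=
  setIntegral_mono_on (hf.integrableOn a b) (hg.integrableOn a b) (measurableSet_rect a b)
    fun z hz => h z.1 hz.1 z.2 hz.2

theorem rectInt_add (hf : Smooth2 f) (hg : Smooth2 g) :
    rectInt a b (f + g) = rectInt a b f + rectInt a b g :=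
  integral_add (hf.integrableOn a b) (hg.integrableOn a b)

theorem rectInt_sub (hf : Smooth2 f) (hg : Smooth2 g) :
    rectInt a b (f - g) = rectInt a b f - rectInt a b g :=
  integral_sub (hf.integrableOn a b) (hg.integrableOn a b)

theorem rectInt_neg : rectInt a b (-f) = -rectInt a b f := integral_neg _

theorem rectInt_const_mul (c : ℝ) :
    rectInt a b (fun x y => c * f x y) = c * rectInt a b f := integral_const_mul _ _

theorem rectInt_const (hab : a ≤ b) (c : ℝ) :
    rectInt a b (fun _ _ => c) = (b - a) * Real.pi * c := by
  unfold rectInt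
  rw [setIntegral_const, rect, measureReal_def, Measure.volume_eq_prod, Measure.prod_prod]
  simp [hab, Real.pi_pos.le, ENNReal.toReal_mul]

theorem rectInt_eq_iterated (hf : Smooth2 f) :
    rectInt a b f = ∫ x in Icc a b, ∫ y in Icc 0 Real.pi, f x y :=
  setIntegral_prod (fun z : ℝ × ℝ => f z.1 z.2) (hf.integrableOn a b)

theorem rectInt_eq_iterated_swap (hf : Smooth2 f) :
    rectInt a b f = ∫ y in Icc 0 Real.pi, ∫ x in Icc a b, f x y := by
  have h := hf.integrableOn a b
  rw [rectInt_eq_iterated hf]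
  refine integral_integral_swap (f := f) ?_
  rwa [Measure.prod_restrict]

theorem integral_Icc_of_hasDerivWithinAt (hab : a ≤ b) {φ φ' : ℝ → ℝ}
    (h : ∀ x ∈ Icc a b, HasDerivWithinAt φ (φ' x) (Icc a b) x) (hc : ContinuousOn φ' (Icc a b)) :
    ∫ x in Icc a b, φ' x = φ b - φ a := by
  rw [integral_Icc_eq_integral_Ioc, ← intervalIntegral.integral_of_le hab]
  refine intervalIntegral.integral_eq_sub_of_hasDerivAt_of_le hab
    (fun x hx => (h x hx).continuousWithinAt)
    (fun x hx => (h x (Ioo_subset_Icc_self hx)).hasDerivAt (Icc_mem_nhds hx.1 hx.2)) ?_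
  exact ContinuousOn.intervalIntegrable_of_Icc hab hc

theorem Smooth2.continuousOn_fst (hf : Smooth2 f) {y : ℝ} (hy : y ∈ Icc 0 Real.pi) (s : Set ℝ) :
    ContinuousOn (fun x => f x y) s :=
  fun x _ => (hf.hasDerivAt x hy).continuousAt.continuousWithinAt

theorem Smooth2.continuousOn_snd (hf : Smooth2 f) (x : ℝ) :
    ContinuousOn (fun y => f x y) (Icc 0 Real.pi) :=
  fun _ hy => (hf.hasDerivWithinAt x hy).continuousWithinAt

theorem rectInt_d1 (hab : a ≤ b) (hf : Smooth2 f) :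
    rectInt a b (d1 f) = ∫ y in Icc 0 Real.pi, (f b y - f a y) := by
  rw [rectInt_eq_iterated_swap hf.d1]
  refine setIntegral_congr_fun measurableSet_Icc fun y hy => ?_
  exact integral_Icc_of_hasDerivWithinAt hab
    (fun x _ => (hf.hasDerivAt x hy).hasDerivWithinAt) (hf.d1.continuousOn_fst hy _)

theorem rectInt_d2 (hf : Smooth2 f) :
    rectInt a b (d2 f) = ∫ x in Icc a b, (f x Real.pi - f x 0) := by
  rw [rectInt_eq_iterated hf.d2]
  refine setIntegral_congr_fun measurableSet_Icc fun x _ => ?_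
  exact integral_Icc_of_hasDerivWithinAt Real.pi_pos.le
    (fun y hy => hf.hasDerivWithinAt x hy) (hf.d2.continuousOn_snd x)

/-- The divergence theorem when the boundary terms cancel. -/
theorem rectInt_div_eq_zero (hab : a ≤ b) (hF : Smooth2 F) (hG : Smooth2 G)
    (hFb : ∀ y ∈ Icc 0 Real.pi, F b y = F a y) (hGb : ∀ x ∈ Icc a b, G x Real.pi = G x 0) :
    rectInt a b (d1 F + d2 G) = 0 := by
  rw [rectInt_add hF.d1 hG.d2, rectInt_d1 hab hF, rectInt_d2 hG,
    setIntegral_congr_fun measurableSet_Icc (g := fun _ => (0 : ℝ))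
      (fun y hy => sub_eq_zero.2 (hFb y hy)),
    setIntegral_congr_fun measurableSet_Icc (g := fun _ => (0 : ℝ))
      (fun x hx => sub_eq_zero.2 (hGb x hx))]
  simp

/-- The common form of the integrations by parts below: exhibit fluxes `F`, `G` and check a
pointwise identity. Asking only that opposite sides carry equal fluxes covers both a full period and
the square, where the fluxes vanish. -/
theorem rectInt_eq_of_div (hab : a ≤ b) (hg : Smooth2 g) (hF : Smooth2 F) (hG : Smooth2 G)
    (hFb : ∀ y ∈ Icc 0 Real.pi, F b y = F a y) (hGb : ∀ x ∈ Icc a b, G x Real.pi = G x 0)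
    (h : ∀ x ∈ Icc a b, ∀ y ∈ Icc 0 Real.pi, f x y = d1 F x y + d2 G x y + g x y) :
    rectInt a b f = rectInt a b g := by
  rw [rectInt_congr (g := (d1 F + d2 G) + g) h, rectInt_add (hF.d1.add hG.d2) hg,
    rectInt_div_eq_zero hab hF hG hFb hGb, zero_add]

theorem Smooth2.exists_bound (hf : Smooth2 f) (a b : ℝ) :
    ∃ C : ℝ, ∀ x ∈ Icc a b, ∀ y ∈ Icc 0 Real.pi, |f x y| ≤ C := by
  obtain ⟨C, hC⟩ := (isCompact_rect a b).exists_bound_of_continuousOn (hf.continuousOn_rect a b)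
  exact ⟨C, fun x hx y hy => hC (x, y) ⟨hx, hy⟩⟩

/-- A nonnegative function with zero integral vanishes. -/
theorem eq_zero_of_rectInt_nonpos (hab : a < b) (hf : Smooth2 f)
    (hf0 : ∀ x ∈ Icc a b, ∀ y ∈ Icc 0 Real.pi, 0 ≤ f x y) (hint : rectInt a b f ≤ 0) :
    ∀ x ∈ Icc a b, ∀ y ∈ Icc 0 Real.pi, f x y = 0 := by
  have h0 : rectInt a b f = 0 := le_antisymm hint
    (setIntegral_nonneg (measurableSet_rect a b) fun z hz => hf0 z.1 hz.1 z.2 hz.2)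
  have hae : (fun z : ℝ × ℝ => f z.1 z.2) =ᵐ[volume.restrict (rect a b)] 0 := by
    rwa [rectInt, setIntegral_eq_zero_iff_of_nonneg_ae _ (hf.integrableOn a b)] at h0
    filter_upwards [ae_restrict_mem (measurableSet_rect a b)] with z hz
    exact hf0 z.1 hz.1 z.2 hz.2
  have hint' : interior (rect a b) = Ioo a b ×ˢ Ioo 0 Real.pi := by
    rw [rect, interior_prod_eq, interior_Icc, interior_Icc]
  have hcl : rect a b ⊆ closure (interior (rect a b)) := by
    rw [hint', closure_prod_eq, closure_Ioo hab.ne, closure_Ioo Real.pi_pos.ne]; rfl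
  have := Measure.eqOn_of_ae_eq hae (hf.continuousOn_rect a b) continuousOn_const hcl
  exact fun x hx y hy => this (x := (x, y)) ⟨hx, hy⟩

/-! ### Time evolution of integrals over rectangles. -/

section Time

variable {T : EReal} {g : ℝ → ℝ → ℝ → ℝ}

theorem Smooth3.continuousOn (hg : Smooth3 T g) {t : ℝ} (ht : t ∈ timeInterval T) (a b : ℝ) :
    ContinuousOn (fun z : ℝ × ℝ × ℝ => g z.1 z.2.1 z.2.2) (Icc 0 t ×ˢ rect a b) :=
  (ContDiffOn.continuousOn hg).mono
    (prod_mono (Icc_subset_timeInterval ht) (prod_mono (subset_univ _) subset_rfl))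

theorem Smooth3.exists_bound (hg : Smooth3 T g) {t : ℝ} (ht : t ∈ timeInterval T) (a b : ℝ) :
    ∃ C : ℝ, ∀ s ∈ Icc 0 t, ∀ x ∈ Icc a b, ∀ y ∈ Icc 0 Real.pi, |g s x y| ≤ C := by
  obtain ⟨C, hC⟩ := (isCompact_Icc.prod (isCompact_rect a b)).exists_bound_of_continuousOn
    (hg.continuousOn ht a b)
  exact ⟨C, fun s hs x hx y hy => hC (s, x, y) ⟨hs, hx, hy⟩⟩

/-- Fubini and the fundamental theorem of calculus at each point replace differentiation under the
integral sign. -/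
theorem rectInt_sub_eq_integral_dt (hT : 0 < T) (hg : Smooth3 T g) {t : ℝ}
    (ht : t ∈ timeInterval T) :
    rectInt a b (g t) - rectInt a b (g 0) = ∫ s in Icc 0 t, rectInt a b (dt T g s) := by
  have h0 : (0 : ℝ) ∈ timeInterval T := zero_mem_timeInterval hT
  rw [← rectInt_sub (hg.slice ht) (hg.slice h0)]
  have hi : IntegrableOn (fun z : ℝ × ℝ × ℝ => dt T g z.1 z.2.1 z.2.2) (Icc 0 t ×ˢ rect a b) :=
    ((hg.dt hT).continuousOn ht a b).integrableOn_compact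
      (isCompact_Icc.prod (isCompact_rect a b))
  have hswap : ∫ s in Icc 0 t, ∫ z in rect a b, dt T g s z.1 z.2
      = ∫ z in rect a b, ∫ s in Icc 0 t, dt T g s z.1 z.2 := by
    refine integral_integral_swap (f := fun s (z : ℝ × ℝ) => dt T g s z.1 z.2) ?_
    rw [Measure.prod_restrict]; exact hi
  unfold rectInt
  rw [hswap]
  refine setIntegral_congr_fun (measurableSet_rect a b) fun z hz => ?_
  refine (integral_Icc_of_hasDerivWithinAt (φ := fun s => g s z.1 z.2) ht.1 (fun s hs => ?_)
    fun s hs => ?_).symm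
  · exact (hg.hasDerivWithinAt hT (Icc_subset_timeInterval ht hs) z.1 hz.2).mono
      (Icc_subset_timeInterval ht)
  · exact (((hg.dt hT).hasDerivWithinAt hT (Icc_subset_timeInterval ht hs) z.1 hz.2).mono
      (Icc_subset_timeInterval ht)).continuousWithinAt

theorem rectInt_le_of_dt_nonpos (hT : 0 < T) (hg : Smooth3 T g) {t : ℝ} (ht : t ∈ timeInterval T)
    (h : ∀ s ∈ Icc 0 t, rectInt a b (dt T g s) ≤ 0) :
    rectInt a b (g t) ≤ rectInt a b (g 0) := by
  rw [← sub_nonpos, rectInt_sub_eq_integral_dt hT hg ht]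
  exact setIntegral_nonpos measurableSet_Icc h

/-- Grönwall's inequality for the integral of a smooth function. -/
theorem rectInt_nonpos_of_dt_le (hT : 0 < T) (hg : Smooth3 T g) {t : ℝ} (ht : t ∈ timeInterval T)
    (C : ℝ) (h : ∀ s ∈ Icc 0 t, rectInt a b (dt T g s) ≤ C * rectInt a b (g s))
    (h0 : rectInt a b (g 0) ≤ 0) : rectInt a b (g t) ≤ 0 := by
  -- Integrating factor: the integral of `e * g` is nonincreasing.
  set e : ℝ → ℝ → ℝ → ℝ := fun s _ _ => Real.exp (-C * s) with he_def
  have he : Smooth3 T e :=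
    smooth3_time (φ := fun s => Real.exp (-C * s)) (by fun_prop)
  have key := rectInt_le_of_dt_nonpos (a := a) (b := b) hT (he.mul hg) ht fun s hs => by
    have hs' := Icc_subset_timeInterval ht hs
    have hd : HasDerivAt (fun s => Real.exp (-C * s)) (Real.exp (-C * s) * (-C)) s := by
      simpa using ((hasDerivAt_id s).const_mul (-C)).exp
    have : rectInt a b (dt T (e * g) s)
        = Real.exp (-C * s) * (rectInt a b (dt T g s) - C * rectInt a b (g s)) := by
      rw [← rectInt_const_mul C, ← rectInt_sub (g := fun x y => C * g s x y) ((hg.dt hT).slice hs')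
        ((smooth2_const C).mul (hg.slice hs')), ← rectInt_const_mul]
      refine rectInt_congr fun x _ y hy => ?_
      rw [he.dt_mul hT hg hs' x hy, he_def, dt_time hT hd hs']
      simp only [Pi.sub_apply]
      ring
    rw [this]
    exact mul_nonpos_of_nonneg_of_nonpos (Real.exp_pos _).le (by linarith [h s hs])
  have e1 : ∀ s, rectInt a b ((e * g) s) = Real.exp (-C * s) * rectInt a b (g s) :=
    fun s => rectInt_const_mul _
  rw [e1, e1] at key
  have : Real.exp (-C * t) * rectInt a b (g t) ≤ 0 :=
    key.trans (mul_nonpos_of_nonneg_of_nonpos (Real.exp_pos _).le h0)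
  exact nonpos_of_mul_nonpos_right this (Real.exp_pos _)

end Time

end BoussinesqStrip

namespace BoussinesqStrip

/-! ### A maximum principle -/

/-- If `∂ₜ f ≤ M` at every spatial maximum point, then `max f(t)` grows at most at rate `M`. -/
theorem le_add_mul_of_dt_le_at_max {X : Type*} [TopologicalSpace X] {K : Set X} (hK : IsCompact K)
    {f f' : ℝ → X → ℝ} {t₀ B M : ℝ} (ht₀ : 0 ≤ t₀)
    (hf : ContinuousOn (fun z : ℝ × X => f z.1 z.2) (Icc 0 t₀ ×ˢ K))
    (hd : ∀ t ∈ Icc 0 t₀, ∀ x ∈ K, HasDerivWithinAt (fun s => f s x) (f' t x) (Icc 0 t₀) t)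
    (h0 : ∀ x ∈ K, f 0 x ≤ B)
    (hmax : ∀ t ∈ Icc 0 t₀, ∀ x ∈ K, (∀ y ∈ K, f t y ≤ f t x) → f' t x ≤ M) :
    ∀ t ∈ Icc 0 t₀, ∀ x ∈ K, f t x ≤ B + M * t := by
  intro t ht x hx
  refine le_of_forall_pos_le_add fun ε hε => ?_
  -- Tilting by slope `M + δ` makes the bound on `f'` strict; this `δ` keeps the total extra tilt
  -- below `ε`.
  set δ : ℝ := ε / (t₀ + 1)
  have hδ : 0 < δ := by positivity
  have hcont : ContinuousOn (fun z : ℝ × X => f z.1 z.2 - (M + δ) * z.1) (Icc 0 t₀ ×ˢ K) :=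
    hf.sub (by fun_prop)
  obtain ⟨⟨s, y⟩, ⟨hs, hy⟩, hmx⟩ := (isCompact_Icc.prod hK).exists_isMaxOn
    ⟨((0 : ℝ), x), ⟨le_rfl, ht₀⟩, hx⟩ hcont
  have hle : ∀ r ∈ Icc 0 t₀, ∀ z ∈ K, f r z - (M + δ) * r ≤ f s y - (M + δ) * s :=
    fun r hr z hz => hmx (a := (r, z)) ⟨hr, hz⟩
  have hs0 : s = 0 := by
    by_contra hne
    have hspos : 0 < s := lt_of_le_of_ne hs.1 (Ne.symm hne)
    have h1 := hmax s hs y hy fun z hz => by linarith [hle s hs z hz]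
    have h2 : HasDerivWithinAt (fun r => f r y - (M + δ) * r) (f' s y - (M + δ) * 1) (Icc 0 s) s :=
      ((hd s hs y hy).mono (Icc_subset_Icc_right hs.2)).fun_sub
        ((hasDerivWithinAt_id s _).const_mul (M + δ))
    have h3 : IsMaxOn (fun r => f r y - (M + δ) * r) (Icc 0 s) s :=
      fun r hr => hle r ⟨hr.1, hr.2.trans hs.2⟩ y hy
    -- At a maximum with `s > 0`, moving backwards in time gives `f' ≥ M + δ`, against `f' ≤ M`.
    -- Only the left derivative is needed, so `s = t₀` is included.
    have h4 := h3.localize.hasFDerivWithinAt_nonpos h2.hasFDerivWithinAt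
      (sub_mem_posTangentConeAt_of_segment_subset (y := 0) (x := s)
        (by rw [segment_symm, segment_eq_Icc hspos.le]))
    simp at h4
    nlinarith
  have h5 := hle t ht x hx
  rw [hs0] at h5
  have h6 : δ * t ≤ ε := by
    have : δ * t ≤ δ * (t₀ + 1) := by gcongr; linarith [ht.2]
    rwa [div_mul_cancel₀ _ (by linarith)] at this
  have := h0 y hy
  nlinarith

end BoussinesqStrip

namespace BoussinesqStrip

/-! ### Incompressible flows tangent to the walls -/

/-- The advection operator `u · ∇`. -/
noncomputable def adv (u₁ u₂ f : ℝ → ℝ → ℝ) : ℝ → ℝ → ℝ := u₁ * d1 f + u₂ * d2 f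

/-- A smooth divergence-free vector field on the strip that is tangent to the walls. -/
structure TangentFlow (u₁ u₂ : ℝ → ℝ → ℝ) : Prop where
  smooth₁ : Smooth2 u₁
  smooth₂ : Smooth2 u₂
  div_eq : ∀ x, ∀ y ∈ Icc 0 Real.pi, d1 u₁ x y + d2 u₂ x y = 0
  bottom : ∀ x, u₂ x 0 = 0
  top : ∀ x, u₂ x Real.pi = 0

variable {a b : ℝ} {u₁ u₂ v₁ v₂ w f g r s : ℝ → ℝ → ℝ}

theorem zero_mem_Icc_pi : (0 : ℝ) ∈ Icc 0 Real.pi := left_mem_Icc.2 Real.pi_pos.le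
theorem pi_mem_Icc_pi : Real.pi ∈ Icc 0 Real.pi := right_mem_Icc.2 Real.pi_pos.le

theorem Smooth2.adv (h₁ : Smooth2 u₁) (h₂ : Smooth2 u₂) (hf : Smooth2 f) :
    Smooth2 (adv u₁ u₂ f) := (h₁.mul hf.d1).add (h₂.mul hf.d2)

theorem SmoothOnStrip.smooth2 (hf : SmoothOnStrip f) : Smooth2 f := hf.smooth

/-- The stream function of a Biot-Savart velocity, with all the relations on the strip. -/
structure IsStream (ψ ω u₁ u₂ : ℝ → ℝ → ℝ) : Prop where
  smooth : Smooth2 ψ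
  periodic : PeriodicX1 ψ
  bottom : ∀ x, ψ x 0 = 0
  top : ∀ x, ψ x Real.pi = 0
  d2_eq : ∀ x, ∀ y ∈ Icc 0 Real.pi, d2 ψ x y = u₁ x y
  d1_eq : ∀ x, ∀ y ∈ Icc 0 Real.pi, d1 ψ x y = -u₂ x y
  curl_eq : ∀ x, ∀ y ∈ Icc 0 Real.pi, ω x y = d1 u₂ x y - d2 u₁ x y
  flow : TangentFlow u₁ u₂

theorem BiotSavart.exists_isStream {ω : ℝ → ℝ → ℝ} (h : BiotSavart ω u₁ u₂) :
    ∃ ψ, IsStream ψ ω u₁ u₂ := by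
  obtain ⟨ψ, hψ, hu⟩ := h
  have hs : Smooth2 ψ := hψ.smooth.smooth2
  have e1 : ∀ x, ∀ y ∈ Icc 0 Real.pi, u₁ x y = d2 ψ x y := fun x y hy => (hu x y hy).1
  have e2 : ∀ x, ∀ y ∈ Icc 0 Real.pi, u₂ x y = (-d1 ψ) x y := fun x y hy => (hu x y hy).2
  have hd1 : ∀ x, ∀ y ∈ Icc 0 Real.pi, d1 u₂ x y = -d1 (d1 ψ) x y := fun x y hy => by
    rw [d1_congr (fun x => e2 x y hy), d1_neg]
  have hd2 : ∀ x, ∀ y ∈ Icc 0 Real.pi, d2 u₁ x y = d2 (d2 ψ) x y := fun x y hy =>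
    d2_congr (e1 x) hy
  refine ⟨ψ, hs, hψ.smooth.periodic, hψ.bottom, hψ.top, fun x y hy => (e1 x y hy).symm,
    fun x y hy => by simp [e2 x y hy], fun x y hy => ?_,
    hs.d2.congr e1, hs.d1.neg.congr e2, fun x y hy => ?_, fun x => ?_, fun x => ?_⟩
  · rw [hd1 x y hy, hd2 x y hy, ← hψ.poisson x y hy]; ring
  · rw [d1_congr (fun x => e1 x y hy), d2_congr (e2 x) hy, d2_neg, hs.d1_d2_comm x hy]; ring
  · rw [e2 x 0 zero_mem_Icc_pi]
    simp [d1, hψ.bottom]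
  · rw [e2 x _ pi_mem_Icc_pi]
    simp [d1, hψ.top]

theorem TangentFlow.sub (h : TangentFlow u₁ u₂) (h' : TangentFlow v₁ v₂) :
    TangentFlow (u₁ - v₁) (u₂ - v₂) where
  smooth₁ := h.smooth₁.sub h'.smooth₁
  smooth₂ := h.smooth₂.sub h'.smooth₂
  div_eq x y hy := by
    rw [h.smooth₁.d1_sub h'.smooth₁ x hy, h.smooth₂.d2_sub h'.smooth₂ x hy]
    linarith [h.div_eq x y hy, h'.div_eq x y hy]
  bottom x := by simp [h.bottom x, h'.bottom x]
  top x := by simp [h.top x, h'.top x]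

theorem IsStream.sub {ψ ω ψ' ω' : ℝ → ℝ → ℝ} (h : IsStream ψ ω u₁ u₂)
    (h' : IsStream ψ' ω' v₁ v₂) : IsStream (ψ - ψ') (ω - ω') (u₁ - v₁) (u₂ - v₂) where
  smooth := h.smooth.sub h'.smooth
  periodic x y hy := by simp [h.periodic x y hy, h'.periodic x y hy]
  bottom x := by simp [h.bottom x, h'.bottom x]
  top x := by simp [h.top x, h'.top x]
  d2_eq x y hy := by
    rw [h.smooth.d2_sub h'.smooth x hy]; simp [h.d2_eq x y hy, h'.d2_eq x y hy]
  d1_eq x y hy := by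
    rw [h.smooth.d1_sub h'.smooth x hy, h.d1_eq x y hy, h'.d1_eq x y hy]; simp; ring
  curl_eq x y hy := by
    rw [h.flow.smooth₂.d1_sub h'.flow.smooth₂ x hy, h.flow.smooth₁.d2_sub h'.flow.smooth₁ x hy]
    simp [h.curl_eq x y hy, h'.curl_eq x y hy]; ring
  flow := h.flow.sub h'.flow

/-! ### Integration by parts -/

theorem rectInt_mul_d1 (hab : a ≤ b) (hs : Smooth2 s) (hr : Smooth2 r)
    (hbd : ∀ y ∈ Icc 0 Real.pi, s b y * r b y = s a y * r a y) :
    rectInt a b (s * d1 r) = -rectInt a b (d1 s * r) := by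
  rw [← rectInt_neg]
  refine rectInt_eq_of_div hab (hs.d1.mul hr).neg (hs.mul hr) (smooth2_const 0) hbd (by simp)
    fun x _ y hy => ?_
  rw [hs.d1_mul hr x hy, d2_const_fun]; simp

/-- Advection by a divergence-free field is skew-adjoint: `f u·∇g + g u·∇f` is the divergence of `u
f g`, with no flux through the walls. -/
theorem TangentFlow.rectInt_mul_adv (hu : TangentFlow u₁ u₂) (hab : a ≤ b) (hf : Smooth2 f)
    (hg : Smooth2 g)
    (hbd : ∀ y ∈ Icc 0 Real.pi, u₁ b y * (f b y * g b y) = u₁ a y * (f a y * g a y)) :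
    rectInt a b (f * adv u₁ u₂ g) = -rectInt a b (g * adv u₁ u₂ f) := by
  rw [← rectInt_neg]
  have h1 := hu.smooth₁
  have h2 := hu.smooth₂
  refine rectInt_eq_of_div hab (hg.mul (h1.adv h2 hf)).neg
    (h1.mul (hf.mul hg)) (h2.mul (hf.mul hg)) hbd
    (fun x _ => by simp [hu.bottom x, hu.top x]) fun x _ y hy => ?_
  rw [h1.d1_mul (hf.mul hg) x hy, h2.d2_mul (hf.mul hg) x hy, hf.d1_mul hg x hy,
    hf.d2_mul hg x hy]
  simp only [Pi.mul_apply, Pi.neg_apply, Pi.add_apply, BoussinesqStrip.adv]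
  linear_combination (-f x y * g x y) * hu.div_eq x y hy

theorem TangentFlow.rectInt_adv (hu : TangentFlow u₁ u₂) (hab : a ≤ b) (hf : Smooth2 f)
    (hbd : ∀ y ∈ Icc 0 Real.pi, u₁ b y * f b y = u₁ a y * f a y) :
    rectInt a b (adv u₁ u₂ f) = 0 := by
  have h1 := hu.smooth₁
  have h2 := hu.smooth₂
  rw [rectInt_eq_of_div (g := fun _ _ => 0) hab (smooth2_const 0)
    (h1.mul hf) (h2.mul hf) hbd (fun x _ => by simp [hu.bottom x, hu.top x]) fun x _ y hy => ?_,
    rectInt_const hab, mul_zero]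
  rw [h1.d1_mul hf x hy, h2.d2_mul hf x hy]
  simp only [Pi.mul_apply, Pi.add_apply, BoussinesqStrip.adv]
  linear_combination (-f x y) * hu.div_eq x y hy

/-- Since `u = ∇^⊥ψ`, moving the gradient onto `v` leaves its curl. Pairing `u` with `∂ₜu` thus
involves only the vorticity equation, and no pressure. -/
theorem IsStream.rectInt_dot {ψ ω : ℝ → ℝ → ℝ} (h : IsStream ψ ω u₁ u₂) (hab : a ≤ b)
    (h₁ : Smooth2 v₁) (h₂ : Smooth2 v₂)
    (hbd : ∀ y ∈ Icc 0 Real.pi, ψ b y * v₂ b y = ψ a y * v₂ a y) :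
    rectInt a b (u₁ * v₁ + u₂ * v₂) = rectInt a b (ψ * (d1 v₂ - d2 v₁)) := by
  have hs := h.smooth
  refine rectInt_eq_of_div hab (hs.mul (h₂.d1.sub h₁.d2)) (hs.mul h₂).neg (hs.mul h₁)
    (fun y hy => by simp [hbd y hy]) (fun x _ => by simp [h.bottom x, h.top x]) fun x _ y hy => ?_
  rw [d1_neg, hs.d1_mul h₂ x hy, hs.d2_mul h₁ x hy, h.d1_eq x y hy, h.d2_eq x y hy]
  simp only [Pi.mul_apply, Pi.add_apply, Pi.sub_apply]
  ring

theorem IsStream.adv_self {ψ ω : ℝ → ℝ → ℝ} (h : IsStream ψ ω u₁ u₂) (x : ℝ) {y : ℝ}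
    (hy : y ∈ Icc 0 Real.pi) : adv u₁ u₂ ψ x y = 0 := by
  simp only [adv, Pi.add_apply, Pi.mul_apply, h.d1_eq x y hy, h.d2_eq x y hy]; ring

/-- Skew-adjointness moves the advection onto `ψ`, which is constant along the streamlines of its
own velocity. -/
theorem IsStream.rectInt_mul_adv_self {ψ ω : ℝ → ℝ → ℝ} (h : IsStream ψ ω u₁ u₂) (hab : a ≤ b)
    (hg : Smooth2 g)
    (hbd : ∀ y ∈ Icc 0 Real.pi, u₁ b y * (ψ b y * g b y) = u₁ a y * (ψ a y * g a y)) :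
    rectInt a b (ψ * adv u₁ u₂ g) = 0 := by
  rw [h.flow.rectInt_mul_adv hab h.smooth hg hbd,
    rectInt_congr (g := fun _ _ => 0) fun x _ y hy => ?_, rectInt_const hab, mul_zero, neg_zero]
  simp [h.adv_self x hy]

/-- For divergence-free `v`, the vector `ω (-v₂, v₁)` is the divergence of the symmetric trace-free
tensor with entries `p = (v₁² - v₂²) / 2` and `v₁ v₂`. Integrating by parts puts the derivative on
`u`, so no derivative of `v` remains and Grönwall can close. -/
theorem IsStream.rectInt_curl_mul_adv {ψ ω : ℝ → ℝ → ℝ} (h : IsStream ψ ω v₁ v₂)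
    (hu : TangentFlow u₁ u₂) (hab : a ≤ b)
    (hbd : ∀ y ∈ Icc 0 Real.pi, u₁ b y = u₁ a y ∧ u₂ b y = u₂ a y ∧ v₁ b y = v₁ a y ∧
      v₂ b y = v₂ a y) {C : ℝ}
    (hC : ∀ x ∈ Icc a b, ∀ y ∈ Icc 0 Real.pi,
      |d1 u₁ x y| ≤ C ∧ |d2 u₁ x y| ≤ C ∧ |d1 u₂ x y| ≤ C ∧ |d2 u₂ x y| ≤ C) :
    rectInt a b (ω * adv u₁ u₂ ψ) ≤ rectInt a b (fun x y => 2 * C * (v₁ x y ^ 2 + v₂ x y ^ 2)) := by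
  have h1 := hu.smooth₁
  have h2 := hu.smooth₂
  have k1 := h.flow.smooth₁
  have k2 := h.flow.smooth₂
  set p : ℝ → ℝ → ℝ := fun x y => 2⁻¹ * (v₁ x y * v₁ x y - v₂ x y * v₂ x y) with hp
  have hhalf : Smooth2 (fun _ _ => (2⁻¹ : ℝ)) := smooth2_const _
  have sp : Smooth2 p := hhalf.mul ((k1.mul k1).sub (k2.mul k2))
  have sq : Smooth2 (v₁ * v₂) := k1.mul k2
  have p1 : ∀ x, ∀ y ∈ Icc 0 Real.pi, d1 p x y = v₁ x y * d1 v₁ x y - v₂ x y * d1 v₂ x y := by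
    intro x y hy
    have := hhalf.d1_mul ((k1.mul k1).sub (k2.mul k2)) x hy
    rw [(k1.mul k1).d1_sub (k2.mul k2) x hy, k1.d1_mul k1 x hy, k2.d1_mul k2 x hy] at this
    refine this.trans ?_
    rw [d1_const_fun (fun _ => 2⁻¹)]; ring
  have p2 : ∀ x, ∀ y ∈ Icc 0 Real.pi, d2 p x y = v₁ x y * d2 v₁ x y - v₂ x y * d2 v₂ x y := by
    intro x y hy
    have := hhalf.d2_mul ((k1.mul k1).sub (k2.mul k2)) x hy
    rw [(k1.mul k1).d2_sub (k2.mul k2) x hy, k1.d2_mul k1 x hy, k2.d2_mul k2 x hy] at this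
    refine this.trans ?_
    rw [d2_const_fun (fun _ => 2⁻¹)]; ring
  rw [rectInt_eq_of_div
    (g := fun x y => p x y * (d2 u₂ x y - d1 u₁ x y)
      - v₁ x y * v₂ x y * (d1 u₂ x y + d2 u₁ x y)) hab
    ((sp.mul (h2.d2.sub h1.d1)).sub (sq.mul (h2.d1.add h1.d2)))
    ((h1.mul sp).add (h2.mul sq)) ((h1.mul sq).sub (h2.mul sp))
    (fun y hy => ?_) (fun x _ => ?_) (fun x _ y hy => ?_)]
  · refine rectInt_mono ((sp.mul (h2.d2.sub h1.d1)).sub (sq.mul (h2.d1.add h1.d2)))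
      ((smooth2_const (2 * C)).mul (((k1.mul k1).add (k2.mul k2)).congr fun x y _ => by
        simp only [Pi.add_apply, Pi.mul_apply]; ring)) fun x hx y hy => ?_
    obtain ⟨c1, c2, c3, c4⟩ := hC x hx y hy
    rw [abs_le] at c1 c2 c3 c4
    have hq := sq_nonneg (v₁ x y + v₂ x y)
    have hq' := sq_nonneg (v₁ x y - v₂ x y)
    simp only [hp]
    have e1 : |d2 u₂ x y - d1 u₁ x y| ≤ 2 * C := abs_le.2 ⟨by linarith, by linarith⟩
    have e2 : |d1 u₂ x y + d2 u₁ x y| ≤ 2 * C := abs_le.2 ⟨by linarith, by linarith⟩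
    rw [abs_le] at e1 e2
    nlinarith [sq_nonneg (v₁ x y), sq_nonneg (v₂ x y),
      mul_nonneg (sq_nonneg (v₁ x y)) (sub_nonneg.2 e1.2),
      mul_nonneg (sq_nonneg (v₂ x y)) (by linarith [e1.1] : 0 ≤ 2 * C + (d2 u₂ x y - d1 u₁ x y)),
      mul_nonneg hq (by linarith [e2.1] : 0 ≤ 2 * C + (d1 u₂ x y + d2 u₁ x y)),
      mul_nonneg hq' (sub_nonneg.2 e2.2)]
  · obtain ⟨b1, b2, b3, b4⟩ := hbd y hy
    simp [hp, b1, b2, b3, b4]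
  · simp [hu.bottom x, hu.top x, h.flow.bottom x, h.flow.top x]
  · rw [(h1.mul sp).d1_add (h2.mul sq) x hy, (h1.mul sq).d2_sub (h2.mul sp) x hy,
      h1.d1_mul sp x hy, h2.d1_mul sq x hy, h1.d2_mul sq x hy, h2.d2_mul sp x hy,
      k1.d1_mul k2 x hy, k1.d2_mul k2 x hy, p1 x y hy, p2 x y hy]
    simp only [adv, Pi.mul_apply, Pi.add_apply, h.d1_eq x y hy, h.d2_eq x y hy, h.curl_eq x y hy]
    linear_combination (-(u₁ x y * v₁ x y + u₂ x y * v₂ x y)) * h.flow.div_eq x y hy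

end BoussinesqStrip

namespace BoussinesqStrip

/-! ### Periodicity -/

variable {T : EReal} {f g : ℝ → ℝ → ℝ}

theorem PeriodicX1.pi_eq (hf : PeriodicX1 f) {y : ℝ} (hy : y ∈ Icc 0 Real.pi) :
    f Real.pi y = f (-Real.pi) y := by
  rw [← hf (-Real.pi) y hy]; congr 1; ring

theorem PeriodicX1.exists_mem (hf : PeriodicX1 f) (x : ℝ) {y : ℝ} (hy : y ∈ Icc 0 Real.pi) :
    ∃ x' ∈ Icc (-Real.pi) Real.pi, f x y = f x' y := by
  have hp : Function.Periodic (fun x => f x y) (2 * Real.pi) := fun x => hf x y hy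
  obtain ⟨x', hx', h⟩ := hp.exists_mem_Ico (by positivity) x (-Real.pi)
  exact ⟨x', ⟨hx'.1, by linarith [hx'.2]⟩, h⟩

theorem PeriodicX1.sub (hf : PeriodicX1 f) (hg : PeriodicX1 g) : PeriodicX1 (f - g) :=
  fun x y hy => by simp [hf x y hy, hg x y hy]

theorem PeriodicX1.d1 (hf : PeriodicX1 f) : PeriodicX1 (d1 f) := fun x y hy => by
  unfold BoussinesqStrip.d1
  rw [← deriv_comp_add_const]
  simp only [hf _ y hy]

theorem PeriodicX1.d2 (hf : PeriodicX1 f) : PeriodicX1 (d2 f) := fun x y hy =>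
  derivWithin_congr (fun z hz => hf x z hz) (hf x y hy)

theorem periodicX1_dt {f : ℝ → ℝ → ℝ → ℝ} (hf : ∀ t ∈ timeInterval T, PeriodicX1 (f t)) {t : ℝ}
    (ht : t ∈ timeInterval T) : PeriodicX1 (dt T f t) := fun x y hy =>
  derivWithin_congr (fun s hs => hf s hs x y hy) (hf t ht x y hy)

theorem neg_pi_lt_pi : -Real.pi < Real.pi := by linarith [Real.pi_pos]

theorem IsStream.periodic₁ {ψ ω u₁ u₂ : ℝ → ℝ → ℝ} (h : IsStream ψ ω u₁ u₂) : PeriodicX1 u₁ :=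
  fun x y hy => by rw [← h.d2_eq x y hy, ← h.d2_eq _ y hy, h.periodic.d2 x y hy]

theorem IsStream.periodic₂ {ψ ω u₁ u₂ : ℝ → ℝ → ℝ} (h : IsStream ψ ω u₁ u₂) : PeriodicX1 u₂ :=
  fun x y hy => by linarith [h.d1_eq x y hy, h.d1_eq (x + 2 * Real.pi) y hy, h.periodic.d1 x y hy]

/-! ### Uniqueness -/

theorem eq_zero_of_rectInt_sq_nonpos {f g : ℝ → ℝ → ℝ} (hf : Smooth2 f) (hg : Smooth2 g)
    (pf : PeriodicX1 f) (h : rectInt (-Real.pi) Real.pi (f * f + g) ≤ 0)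
    (hg0 : ∀ x, ∀ y ∈ Icc 0 Real.pi, 0 ≤ g x y) (x : ℝ) {y : ℝ} (hy : y ∈ Icc 0 Real.pi) :
    f x y = 0 := by
  have key := eq_zero_of_rectInt_nonpos neg_pi_lt_pi ((hf.mul hf).add hg)
    (fun x _ y hy => add_nonneg (mul_self_nonneg _) (hg0 x y hy)) h
  obtain ⟨x', hx', e⟩ := pf.exists_mem x hy
  have h1 := key x' hx' y hy
  have h2 := hg0 x' y hy
  simp only [Pi.add_apply, Pi.mul_apply] at h1
  rw [e]
  nlinarith

/-- The velocity is determined by the vorticity. -/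
theorem IsStream.velocity_eq_zero {ψ ω u₁ u₂ : ℝ → ℝ → ℝ} (h : IsStream ψ ω u₁ u₂)
    (hω : ∀ x, ∀ y ∈ Icc 0 Real.pi, ω x y = 0) (x : ℝ) {y : ℝ} (hy : y ∈ Icc 0 Real.pi) :
    u₁ x y = 0 ∧ u₂ x y = 0 := by
  have s1 := h.flow.smooth₁
  have s2 := h.flow.smooth₂
  have e : rectInt (-Real.pi) Real.pi (u₁ * u₁ + u₂ * u₂) ≤ 0 := by
    rw [h.rectInt_dot neg_pi_lt_pi.le s1 s2
      (fun y hy => by rw [h.periodic.pi_eq hy, h.periodic₂.pi_eq hy]),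
      rectInt_congr (g := fun _ _ => 0) fun x _ y hy => ?_, rectInt_const neg_pi_lt_pi.le, mul_zero]
    simp [← h.curl_eq x y hy, hω x y hy]
  refine ⟨eq_zero_of_rectInt_sq_nonpos s1 (s2.mul s2) h.periodic₁ e
    (fun _ _ _ => mul_self_nonneg _) x hy,
    eq_zero_of_rectInt_sq_nonpos s2 (s1.mul s1) h.periodic₂ (by rwa [add_comm])
    (fun _ _ _ => mul_self_nonneg _) x hy⟩

theorem BiotSavart.unique {ω ω' u₁ u₂ v₁ v₂ : ℝ → ℝ → ℝ} (h : BiotSavart ω u₁ u₂)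
    (h' : BiotSavart ω' v₁ v₂) (hω : ∀ x, ∀ y ∈ Icc 0 Real.pi, ω x y = ω' x y) (x : ℝ) {y : ℝ}
    (hy : y ∈ Icc 0 Real.pi) : u₁ x y = v₁ x y ∧ u₂ x y = v₂ x y := by
  obtain ⟨ψ, hψ⟩ := h.exists_isStream
  obtain ⟨ψ', hψ'⟩ := h'.exists_isStream
  have := (hψ.sub hψ').velocity_eq_zero (fun x y hy => sub_eq_zero.2 (hω x y hy)) x hy
  exact ⟨sub_eq_zero.1 this.1, sub_eq_zero.1 this.2⟩

namespace IsSmoothSolution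

variable {ρ₀ ω₀ : ℝ → ℝ → ℝ} {ρ ω u₁ u₂ ρ' ω' v₁ v₂ : ℝ → ℝ → ℝ → ℝ}

theorem dt_density (h : IsSmoothSolution T ρ₀ ω₀ ρ ω u₁ u₂) {t : ℝ} (ht : t ∈ timeInterval T)
    (x : ℝ) {y : ℝ} (hy : y ∈ Icc 0 Real.pi) : dt T ρ t x y = -adv (u₁ t) (u₂ t) (ρ t) x y := by
  have := h.density_eq t ht x y hy
  simp only [adv, Pi.add_apply, Pi.mul_apply]; linarith

theorem dt_vorticity (h : IsSmoothSolution T ρ₀ ω₀ ρ ω u₁ u₂) {t : ℝ} (ht : t ∈ timeInterval T)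
    (x : ℝ) {y : ℝ} (hy : y ∈ Icc 0 Real.pi) :
    dt T ω t x y = -d1 (ρ t) x y - adv (u₁ t) (u₂ t) (ω t) x y := by
  have := h.vorticity_eq t ht x y hy
  simp only [adv, Pi.add_apply, Pi.mul_apply]; linarith

theorem exists_isStream (h : IsSmoothSolution T ρ₀ ω₀ ρ ω u₁ u₂) {t : ℝ}
    (ht : t ∈ timeInterval T) : ∃ ψ, IsStream ψ (ω t) (u₁ t) (u₂ t) :=
  (h.biot_savart t ht).exists_isStream

end IsSmoothSolution

/-- The curl of the time derivative of the velocity is the time derivative of the vorticity. -/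
theorem curl_dt_eq (hT : 0 < T) {w₁ w₂ ω : ℝ → ℝ → ℝ → ℝ} (h₁ : Smooth3 T w₁) (h₂ : Smooth3 T w₂)
    (hc : ∀ t ∈ timeInterval T, ∀ x, ∀ y ∈ Icc 0 Real.pi,
      ω t x y = d1 (w₂ t) x y - d2 (w₁ t) x y)
    {t : ℝ} (ht : t ∈ timeInterval T) (x : ℝ) {y : ℝ} (hy : y ∈ Icc 0 Real.pi) :
    d1 (dt T w₂ t) x y - d2 (dt T w₁ t) x y = dt T ω t x y := by
  rw [dt_congr (g := (fun t => d1 (w₂ t)) - fun t => d2 (w₁ t)) hc ht x hy,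
    (h₂.d1 hT).dt_sub hT (h₁.d2 hT) ht x hy, h₂.dt_d1_comm hT ht x hy, h₁.dt_d2_comm hT ht x hy]

namespace IsSmoothSolution

variable {ρ₀ ω₀ : ℝ → ℝ → ℝ} {ρ ω u₁ u₂ ρ' ω' v₁ v₂ : ℝ → ℝ → ℝ → ℝ}

/-- Splits the difference of the nonlinear terms into transport of the difference and advection of
the second solution by the velocity difference. -/
theorem adv_sub_adv {a₁ a₂ b₁ b₂ f g : ℝ → ℝ → ℝ} (hf : Smooth2 f) (hg : Smooth2 g) (x : ℝ)
    {y : ℝ} (hy : y ∈ Icc 0 Real.pi) :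
    adv a₁ a₂ f x y - adv b₁ b₂ g x y = adv a₁ a₂ (f - g) x y + adv (a₁ - b₁) (a₂ - b₂) g x y := by
  simp only [adv, Pi.add_apply, Pi.mul_apply, Pi.sub_apply, hf.d1_sub hg x hy, hf.d2_sub hg x hy]
  ring

/-- The energy estimate for the difference of two solutions. -/
theorem rectInt_dt_diff_le (hT : 0 < T) (h : IsSmoothSolution T ρ₀ ω₀ ρ ω u₁ u₂)
    (h' : IsSmoothSolution T ρ₀ ω₀ ρ' ω' v₁ v₂) {t : ℝ} (ht : t ∈ timeInterval T) {C : ℝ}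
    (hC0 : 0 ≤ C)
    (hC : ∀ x ∈ Icc (-Real.pi) Real.pi, ∀ y ∈ Icc 0 Real.pi,
      |d1 (u₁ t) x y| ≤ C ∧ |d2 (u₁ t) x y| ≤ C ∧ |d1 (u₂ t) x y| ≤ C ∧ |d2 (u₂ t) x y| ≤ C)
    (hC' : ∀ x ∈ Icc (-Real.pi) Real.pi, ∀ y ∈ Icc 0 Real.pi,
      |d1 (ρ' t) x y| ≤ C ∧ |d2 (ρ' t) x y| ≤ C) :
    rectInt (-Real.pi) Real.pi (dt T ((u₁ - v₁) * (u₁ - v₁) + (u₂ - v₂) * (u₂ - v₂)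
        + (ρ - ρ') * (ρ - ρ')) t)
      ≤ 2 * (3 * C + 1) * rectInt (-Real.pi) Real.pi (((u₁ - v₁) * (u₁ - v₁)
        + (u₂ - v₂) * (u₂ - v₂) + (ρ - ρ') * (ρ - ρ')) t) := by
  have hab := neg_pi_lt_pi.le
  obtain ⟨ψ, hψ⟩ := h.exists_isStream ht
  obtain ⟨ψ', hψ'⟩ := h'.exists_isStream ht
  have S := hψ.sub hψ'
  have sρ : Smooth3 T ρ := h.smooth_density.smooth
  have sρ' : Smooth3 T ρ' := h'.smooth_density.smooth
  have sω : Smooth3 T ω := h.smooth_vorticity.smooth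
  have sω' : Smooth3 T ω' := h'.smooth_vorticity.smooth
  have su₁ : Smooth3 T u₁ := h.smooth_velocity₁.smooth
  have su₂ : Smooth3 T u₂ := h.smooth_velocity₂.smooth
  have sv₁ : Smooth3 T v₁ := h'.smooth_velocity₁.smooth
  have sv₂ : Smooth3 T v₂ := h'.smooth_velocity₂.smooth
  have sw₁ := su₁.sub sv₁
  have sw₂ := su₂.sub sv₂
  have sr := sρ.sub sρ'
  have sw := sω.sub sω'
  have pw₂ : ∀ t ∈ timeInterval T, PeriodicX1 ((u₂ - v₂) t) := fun t ht =>
    (h.smooth_velocity₂.periodic t ht).sub (h'.smooth_velocity₂.periodic t ht)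
  have pr : PeriodicX1 ((ρ - ρ') t) := (h.smooth_density.periodic t ht).sub (h'.smooth_density.periodic t ht)
  have pw : PeriodicX1 ((ω - ω') t) := (h.smooth_vorticity.periodic t ht).sub (h'.smooth_vorticity.periodic t ht)
  have pu₁ := h.smooth_velocity₁.periodic t ht
  have pu₂ := h.smooth_velocity₂.periodic t ht
  set Ψ := ψ - ψ'
  have hcurl : ∀ t ∈ timeInterval T, ∀ x, ∀ y ∈ Icc 0 Real.pi,
      (ω - ω') t x y = d1 ((u₂ - v₂) t) x y - d2 ((u₁ - v₁) t) x y := by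
    intro t ht x y hy
    obtain ⟨ψ, hψ⟩ := h.exists_isStream ht
    obtain ⟨ψ', hψ'⟩ := h'.exists_isStream ht
    exact (hψ.sub hψ').curl_eq x y hy
  set r := (ρ - ρ') t
  set w := (ω - ω') t
  set w₁ := (u₁ - v₁) t
  set w₂ := (u₂ - v₂) t
  have S' : IsStream Ψ w w₁ w₂ := S
  have sr2 : Smooth2 r := sr.slice ht
  have sw2 : Smooth2 w := sw.slice ht
  have sΨ := S'.smooth
  have f1 := S'.flow.smooth₁
  have f2 := S'.flow.smooth₂
  have tr : ∀ x, ∀ y ∈ Icc 0 Real.pi, dt T (ρ - ρ') t x y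
      = -adv (u₁ t) (u₂ t) r x y - adv w₁ w₂ (ρ' t) x y := fun x y hy => by
    rw [sρ.dt_sub hT sρ' ht x hy, h.dt_density ht x hy, h'.dt_density ht x hy]
    have e : adv (u₁ t) (u₂ t) (ρ t) x y - adv (v₁ t) (v₂ t) (ρ' t) x y
      = adv (u₁ t) (u₂ t) r x y + adv w₁ w₂ (ρ' t) x y :=
      adv_sub_adv (sρ.slice ht) (sρ'.slice ht) x hy
    linarith
  have tw : ∀ x, ∀ y ∈ Icc 0 Real.pi, dt T (ω - ω') t x y
      = -d1 r x y - adv (u₁ t) (u₂ t) w x y - adv w₁ w₂ (ω' t) x y := fun x y hy => by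
    rw [sω.dt_sub hT sω' ht x hy, h.dt_vorticity ht x hy, h'.dt_vorticity ht x hy]
    have e : adv (u₁ t) (u₂ t) (ω t) x y - adv (v₁ t) (v₂ t) (ω' t) x y
      = adv (u₁ t) (u₂ t) w x y + adv w₁ w₂ (ω' t) x y :=
      adv_sub_adv (sω.slice ht) (sω'.slice ht) x hy
    have e' : d1 r x y = d1 (ρ t) x y - d1 (ρ' t) x y :=
      (sρ.slice ht).d1_sub (sρ'.slice ht) x hy
    linarith
  have sA := hψ.flow.smooth₁.adv hψ.flow.smooth₂ sw2
  have sB := f1.adv f2 (sω'.slice ht)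
  have sA' := hψ.flow.smooth₁.adv hψ.flow.smooth₂ sr2
  have sB' := f1.adv f2 (sρ'.slice ht)
  have d₁ := (sw₁.dt hT).slice ht
  have d₂ := (sw₂.dt hT).slice ht
  -- Pair `∂ₜ` of the vorticity difference with `Ψ`. The buoyancy term and transport by `u` are
  -- integrated by parts; advection of `ω'` by the velocity difference drops, as `Ψ` is the stream
  -- function of that difference.
  have kin : rectInt (-Real.pi) Real.pi (w₁ * dt T (u₁ - v₁) t + w₂ * dt T (u₂ - v₂) t)
      = rectInt (-Real.pi) Real.pi (d1 Ψ * r)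
        + rectInt (-Real.pi) Real.pi (w * adv (u₁ t) (u₂ t) Ψ) := by
    rw [S'.rectInt_dot hab d₁ d₂ (fun y hy => by
        rw [S'.periodic.pi_eq hy, (periodicX1_dt pw₂ ht).pi_eq hy]),
      rectInt_congr (g := (-(Ψ * d1 r) - Ψ * adv (u₁ t) (u₂ t) w) - Ψ * adv w₁ w₂ (ω' t))
        fun x _ y hy => ?_,
      rectInt_sub ((sΨ.mul sr2.d1).neg.sub (sΨ.mul sA)) (sΨ.mul sB),
      rectInt_sub (sΨ.mul sr2.d1).neg (sΨ.mul sA), rectInt_neg,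
      rectInt_mul_d1 hab sΨ sr2 (fun y hy => by rw [S'.periodic.pi_eq hy, pr.pi_eq hy]),
      hψ.flow.rectInt_mul_adv hab sΨ sw2 (fun y hy => by
        rw [S'.periodic.pi_eq hy, pw.pi_eq hy, pu₁.pi_eq hy]),
      S'.rectInt_mul_adv_self hab (sω'.slice ht) (fun y hy => by
        rw [S'.periodic.pi_eq hy, S'.periodic₁.pi_eq hy,
          (h'.smooth_vorticity.periodic t ht).pi_eq hy])]
    · ring
    · simp only [Pi.mul_apply, Pi.sub_apply, Pi.neg_apply]
      have e1 := curl_dt_eq hT sw₁ sw₂ hcurl ht x hy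
      rw [tw x y hy] at e1
      linear_combination Ψ x y * e1
  have quad := S'.rectInt_curl_mul_adv hψ.flow hab (fun y hy =>
    ⟨pu₁.pi_eq hy, pu₂.pi_eq hy, S'.periodic₁.pi_eq hy, S'.periodic₂.pi_eq hy⟩) hC
  -- Transport of `r` by `u` contributes nothing, being skew-adjoint.
  have den : rectInt (-Real.pi) Real.pi (r * dt T (ρ - ρ') t)
      = -rectInt (-Real.pi) Real.pi (r * adv w₁ w₂ (ρ' t)) := by
    have z := hψ.flow.rectInt_mul_adv hab sr2 sr2 (fun y hy => by
        rw [pr.pi_eq hy, pu₁.pi_eq hy])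
    rw [rectInt_congr (g := -(r * adv (u₁ t) (u₂ t) r) - r * adv w₁ w₂ (ρ' t))
        fun x _ y hy => ?_,
      rectInt_sub (sr2.mul sA').neg (sr2.mul sB'), rectInt_neg]
    · linarith
    · simp only [Pi.mul_apply, Pi.sub_apply, Pi.neg_apply, tr x y hy]; ring
  set e := w₁ * w₁ + w₂ * w₂ + r * r
  have se : Smooth2 e := ((f1.mul f1).add (f2.mul f2)).add (sr2.mul sr2)
  have sum : rectInt (-Real.pi) Real.pi (dt T ((u₁ - v₁) * (u₁ - v₁) + (u₂ - v₂) * (u₂ - v₂)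
        + (ρ - ρ') * (ρ - ρ')) t)
      = 2 * (rectInt (-Real.pi) Real.pi (w₁ * dt T (u₁ - v₁) t + w₂ * dt T (u₂ - v₂) t)
        + rectInt (-Real.pi) Real.pi (r * dt T (ρ - ρ') t)) := by
    have sr3 := (sr.dt hT).slice ht
    rw [← rectInt_add ((f1.mul d₁).add (f2.mul d₂)) (sr2.mul sr3), ← rectInt_const_mul]
    refine rectInt_congr fun x _ y hy => ?_
    rw [((sw₁.mul sw₁).add (sw₂.mul sw₂)).dt_add hT (sr.mul sr) ht x hy,
      (sw₁.mul sw₁).dt_add hT (sw₂.mul sw₂) ht x hy, sw₁.dt_mul hT sw₁ ht x hy,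
      sw₂.dt_mul hT sw₂ ht x hy, sr.dt_mul hT sr ht x hy]
    simp only [Pi.mul_apply, Pi.add_apply]; ring
  have sq : Smooth2 (fun x y => 2 * C * (w₁ x y ^ 2 + w₂ x y ^ 2)) :=
    ((smooth2_const (2 * C)).mul ((f1.mul f1).add (f2.mul f2))).congr fun x y _ => by
      simp only [Pi.mul_apply, Pi.add_apply]; ring
  -- Of `3 * C + 1`, the quadratic velocity term takes `2 * C`, the density advection takes `C`, and
  -- the buoyancy term takes the `1`.
  have bd : rectInt (-Real.pi) Real.pi (d1 Ψ * r)
      + rectInt (-Real.pi) Real.pi (fun x y => 2 * C * (w₁ x y ^ 2 + w₂ x y ^ 2))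
      - rectInt (-Real.pi) Real.pi (r * adv w₁ w₂ (ρ' t))
      ≤ (3 * C + 1) * rectInt (-Real.pi) Real.pi e := by
    rw [← rectInt_add (sΨ.d1.mul sr2) sq,
      ← rectInt_sub ((sΨ.d1.mul sr2).add sq) (sr2.mul sB'), ← rectInt_const_mul]
    refine rectInt_mono (((sΨ.d1.mul sr2).add sq).sub (sr2.mul sB'))
      ((smooth2_const (3 * C + 1)).mul se) fun x hx y hy => ?_
    obtain ⟨c1, c2⟩ := hC' x hx y hy
    rw [abs_le] at c1 c2
    simp only [Pi.mul_apply, Pi.add_apply, Pi.sub_apply, adv, e, S'.d1_eq x y hy]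
    have q1 : -(r x y * w₁ x y * d1 (ρ' t) x y) ≤ C * ((r x y ^ 2 + w₁ x y ^ 2) / 2) := by
      nlinarith [mul_nonneg (sq_nonneg (r x y + w₁ x y)) (by linarith : 0 ≤ C + d1 (ρ' t) x y),
        mul_nonneg (sq_nonneg (r x y - w₁ x y)) (by linarith : 0 ≤ C - d1 (ρ' t) x y),
        mul_nonneg (sq_nonneg (r x y + w₁ x y)) (by linarith : 0 ≤ C - d1 (ρ' t) x y),
        mul_nonneg (sq_nonneg (r x y - w₁ x y)) (by linarith : 0 ≤ C + d1 (ρ' t) x y)]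
    have q2 : -(r x y * w₂ x y * d2 (ρ' t) x y) ≤ C * ((r x y ^ 2 + w₂ x y ^ 2) / 2) := by
      nlinarith [mul_nonneg (sq_nonneg (r x y + w₂ x y)) (by linarith : 0 ≤ C + d2 (ρ' t) x y),
        mul_nonneg (sq_nonneg (r x y - w₂ x y)) (by linarith : 0 ≤ C - d2 (ρ' t) x y),
        mul_nonneg (sq_nonneg (r x y + w₂ x y)) (by linarith : 0 ≤ C - d2 (ρ' t) x y),
        mul_nonneg (sq_nonneg (r x y - w₂ x y)) (by linarith : 0 ≤ C + d2 (ρ' t) x y)]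
    nlinarith [sq_nonneg (r x y + w₂ x y), sq_nonneg (r x y), sq_nonneg (w₁ x y),
      sq_nonneg (w₂ x y), mul_nonneg hC0 (sq_nonneg (r x y)), mul_nonneg hC0 (sq_nonneg (w₁ x y)),
      mul_nonneg hC0 (sq_nonneg (w₂ x y))]
  rw [sum, kin, den]
  calc _ ≤ 2 * ((3 * C + 1) * rectInt (-Real.pi) Real.pi e) := by linarith
    _ = _ := by rw [mul_assoc]; rfl

/-- Smooth solutions with the same initial data have the same velocity. -/
theorem velocity_unique (hT : 0 < T) (h : IsSmoothSolution T ρ₀ ω₀ ρ ω u₁ u₂)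
    (h' : IsSmoothSolution T ρ₀ ω₀ ρ' ω' v₁ v₂) {t : ℝ} (ht : t ∈ timeInterval T) (x : ℝ) {y : ℝ}
    (hy : y ∈ Icc 0 Real.pi) : u₁ t x y = v₁ t x y := by
  have sρ : Smooth3 T ρ := h.smooth_density.smooth
  have sρ' : Smooth3 T ρ' := h'.smooth_density.smooth
  have su₁ : Smooth3 T u₁ := h.smooth_velocity₁.smooth
  have su₂ : Smooth3 T u₂ := h.smooth_velocity₂.smooth
  have sw₁ := su₁.sub (g := v₁) h'.smooth_velocity₁.smooth
  have sw₂ := su₂.sub (g := v₂) h'.smooth_velocity₂.smooth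
  have sr := sρ.sub sρ'
  obtain ⟨C₁, hC₁⟩ := (su₁.d1 hT).exists_bound ht (-Real.pi) Real.pi
  obtain ⟨C₂, hC₂⟩ := (su₁.d2 hT).exists_bound ht (-Real.pi) Real.pi
  obtain ⟨C₃, hC₃⟩ := (su₂.d1 hT).exists_bound ht (-Real.pi) Real.pi
  obtain ⟨C₄, hC₄⟩ := (su₂.d2 hT).exists_bound ht (-Real.pi) Real.pi
  obtain ⟨C₅, hC₅⟩ := (sρ'.d1 hT).exists_bound ht (-Real.pi) Real.pi
  obtain ⟨C₆, hC₆⟩ := (sρ'.d2 hT).exists_bound ht (-Real.pi) Real.pi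
  set C := |C₁| + |C₂| + |C₃| + |C₄| + |C₅| + |C₆|
  have n₁ := abs_nonneg C₁
  have n₂ := abs_nonneg C₂
  have n₃ := abs_nonneg C₃
  have n₄ := abs_nonneg C₄
  have n₅ := abs_nonneg C₅
  have n₆ := abs_nonneg C₆
  have i0 := zero_mem_timeInterval hT
  have init : rectInt (-Real.pi) Real.pi (((u₁ - v₁) * (u₁ - v₁) + (u₂ - v₂) * (u₂ - v₂)
      + (ρ - ρ') * (ρ - ρ')) 0) ≤ 0 := by
    rw [rectInt_congr (g := fun _ _ => 0) fun x _ y hy => ?_, rectInt_const neg_pi_lt_pi.le,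
      mul_zero]
    obtain ⟨e1, e2⟩ := (h.biot_savart 0 i0).unique (h'.biot_savart 0 i0)
      (fun x y hy => by rw [h.initial_vorticity x y hy, h'.initial_vorticity x y hy]) x hy
    simp [e1, e2, h.initial_density x y hy, h'.initial_density x y hy]
  have fin := rectInt_nonpos_of_dt_le hT (((sw₁.mul sw₁).add (sw₂.mul sw₂)).add (sr.mul sr)) ht
    (2 * (3 * C + 1)) (fun s hs => rectInt_dt_diff_le hT h h' (Icc_subset_timeInterval ht hs)
      (by positivity)
      (fun x hx y hy => ⟨(hC₁ s hs x hx y hy).trans (by linarith [le_abs_self C₁]),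
        (hC₂ s hs x hx y hy).trans (by linarith [le_abs_self C₂]),
        (hC₃ s hs x hx y hy).trans (by linarith [le_abs_self C₃]),
        (hC₄ s hs x hx y hy).trans (by linarith [le_abs_self C₄])⟩)
      (fun x hx y hy => ⟨(hC₅ s hs x hx y hy).trans (by linarith [le_abs_self C₅]),
        (hC₆ s hs x hx y hy).trans (by linarith [le_abs_self C₆])⟩)) init
  have t1 := sw₁.slice ht
  have t2 := sw₂.slice ht
  have t3 := sr.slice ht
  rw [add_assoc] at fin
  exact sub_eq_zero.1 (eq_zero_of_rectInt_sq_nonpos t1 ((t2.mul t2).add (t3.mul t3))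
    ((h.smooth_velocity₁.periodic t ht).sub (h'.smooth_velocity₁.periodic t ht)) fin
    (fun _ _ _ => add_nonneg (mul_self_nonneg _) (mul_self_nonneg _)) x hy)

end IsSmoothSolution

end BoussinesqStrip

namespace BoussinesqStrip

/-! ### Reflection symmetry -/

variable {T : EReal} {ρ₀ ω₀ : ℝ → ℝ → ℝ} {ρ ω u₁ u₂ : ℝ → ℝ → ℝ → ℝ}

theorem d1_reflect (f : ℝ → ℝ → ℝ) (x y : ℝ) : d1 (fun x y => f (-x) y) x y = -d1 f (-x) y :=
  deriv_comp_neg (fun s => f s y) x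

theorem d2_reflect (f : ℝ → ℝ → ℝ) (x y : ℝ) : d2 (fun x y => f (-x) y) x y = d2 f (-x) y := rfl

theorem d1_neg' (f : ℝ → ℝ → ℝ) (x y : ℝ) : d1 (fun x y => -f x y) x y = -d1 f x y :=
  d1_neg x y

theorem d2_neg' (f : ℝ → ℝ → ℝ) (x y : ℝ) : d2 (fun x y => -f x y) x y = -d2 f x y :=
  d2_neg x y

theorem PeriodicX1.reflect {f : ℝ → ℝ → ℝ} (hf : PeriodicX1 f) :
    PeriodicX1 (fun x y => f (-x) y) := fun x y hy => by
  have := hf (-x - 2 * Real.pi) y hy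
  rw [sub_add_cancel] at this
  change f (-(x + 2 * Real.pi)) y = f (-x) y
  rw [this]; congr 1; ring

theorem PeriodicX1.neg {f : ℝ → ℝ → ℝ} (hf : PeriodicX1 f) :
    PeriodicX1 (fun x y => -f x y) := fun x y hy =>
  congrArg Neg.neg (hf x y hy)

theorem Smooth2.reflect {f : ℝ → ℝ → ℝ} (hf : Smooth2 f) : Smooth2 (fun x y => f (-x) y) :=
  ContDiffOn.comp (g := fun x : ℝ × ℝ => f x.1 x.2) (f := fun x : ℝ × ℝ => (-x.1, x.2)) hf
    (by fun_prop) fun _ hx => ⟨mem_univ _, hx.2⟩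

theorem SmoothOnSpacetime.reflect {f : ℝ → ℝ → ℝ → ℝ} (hf : SmoothOnSpacetime T f) :
    SmoothOnSpacetime T (fun t x y => f t (-x) y) where
  smooth := ContDiffOn.comp (g := fun z : ℝ × ℝ × ℝ => f z.1 z.2.1 z.2.2)
    (f := fun z : ℝ × ℝ × ℝ => (z.1, -z.2.1, z.2.2)) hf.smooth
    (by fun_prop) fun _ hz => ⟨hz.1, mem_univ _, hz.2.2⟩
  periodic t ht := (hf.periodic t ht).reflect

theorem SmoothOnSpacetime.neg {f : ℝ → ℝ → ℝ → ℝ} (hf : SmoothOnSpacetime T f) :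
    SmoothOnSpacetime T (fun t x y => -f t x y) where
  smooth := hf.smooth.neg
  periodic t ht := (hf.periodic t ht).neg

theorem BiotSavart.reflect {ω u₁ u₂ : ℝ → ℝ → ℝ} (h : BiotSavart ω u₁ u₂) :
    BiotSavart (fun x y => -ω (-x) y) (fun x y => -u₁ (-x) y) (fun x y => u₂ (-x) y) := by
  obtain ⟨ψ, hψ, hu⟩ := h
  have e1 : d1 (fun x y => -ψ (-x) y) = fun x y => d1 ψ (-x) y := by
    ext x y; rw [d1_neg' (fun x y => ψ (-x) y), d1_reflect, neg_neg]
  have e2 : d2 (fun x y => -ψ (-x) y) = fun x y => -d2 ψ (-x) y := by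
    ext x y; rw [d2_neg' (fun x y => ψ (-x) y), d2_reflect]
  refine ⟨fun x y => -ψ (-x) y,
    ⟨⟨hψ.smooth.smooth2.reflect.neg, hψ.smooth.periodic.reflect.neg⟩, fun x y hy => ?_,
      fun x => by simp [hψ.bottom], fun x => by simp [hψ.top]⟩, fun x y hy => ?_⟩
  · rw [e1, e2, d1_reflect, d2_neg' (fun x y => d2 ψ (-x) y), d2_reflect, ← hψ.poisson (-x) y hy]
    ring
  · rw [e1, e2]
    simp [(hu (-x) y hy).1, (hu (-x) y hy).2]

namespace IsSmoothSolution

/-- Reflection reverses orientation, so `ω` and `u₁` change sign while `ρ` and `u₂` do not. The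
parity of the data makes the reflected solution start from the same data. -/
theorem reflect (hρ₀ : EvenX1 ρ₀) (hω₀ : OddX1 ω₀) (h : IsSmoothSolution T ρ₀ ω₀ ρ ω u₁ u₂) :
    IsSmoothSolution T ρ₀ ω₀ (fun t x y => ρ t (-x) y) (fun t x y => -ω t (-x) y)
      (fun t x y => -u₁ t (-x) y) (fun t x y => u₂ t (-x) y) where
  smooth_density := h.smooth_density.reflect
  smooth_vorticity := h.smooth_vorticity.reflect.neg
  smooth_velocity₁ := h.smooth_velocity₁.reflect.neg
  smooth_velocity₂ := h.smooth_velocity₂.reflect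
  density_eq t ht x y hy := by
    rw [d1_reflect, d2_reflect, ← h.density_eq t ht (-x) y hy]
    simp only [dt]; ring
  vorticity_eq t ht x y hy := by
    have e : dt T (fun t x y => -ω t (-x) y) t x y = -dt T ω t (-x) y := derivWithin.fun_neg
    rw [e, d1_neg' (fun x y => ω t (-x) y), d2_neg' (fun x y => ω t (-x) y), d1_reflect,
      d2_reflect, d1_reflect]
    linarith [h.vorticity_eq t ht (-x) y hy]
  biot_savart t ht := (h.biot_savart t ht).reflect
  initial_density x y hy := by rw [h.initial_density (-x) y hy, hρ₀ x y hy]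
  initial_vorticity x y hy := by rw [h.initial_vorticity (-x) y hy, hω₀ x y hy, neg_neg]

/-- The symmetry of the data keeps the horizontal velocity zero on the symmetry axes. -/
theorem velocity_axes (hT : 0 < T) (hρ₀ : EvenX1 ρ₀) (hω₀ : OddX1 ω₀)
    (h : IsSmoothSolution T ρ₀ ω₀ ρ ω u₁ u₂) {t : ℝ} (ht : t ∈ timeInterval T) {y : ℝ}
    (hy : y ∈ Icc 0 Real.pi) : u₁ t 0 y = 0 ∧ u₁ t Real.pi y = 0 := by
  -- Uniqueness makes `u₁` odd. At `x = π`, oddness is combined with the periodic identification of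
  -- `-π` with `π`.
  have key := fun x => velocity_unique hT h (h.reflect hρ₀ hω₀) ht x hy
  have k0 := key 0
  have kp := key Real.pi
  rw [← (h.smooth_velocity₁.periodic t ht).pi_eq hy] at kp
  rw [neg_zero] at k0
  constructor <;> linarith

end IsSmoothSolution

/-! ### Transport and the maximum principle -/

/-- At an interior maximum the derivative vanishes; at an endpoint the velocity `v` does. This
dispenses with a flow map. -/
theorem mul_deriv_eq_zero_of_isMax {a b y v φ' : ℝ} {φ : ℝ → ℝ} (hy : y ∈ Icc a b)
    (hφ : HasDerivWithinAt φ φ' (Icc a b) y) (hmax : ∀ z ∈ Icc a b, φ z ≤ φ y)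
    (ha : y = a → v = 0) (hb : y = b → v = 0) : v * φ' = 0 := by
  rcases eq_or_lt_of_le hy.1 with h | h
  · rw [ha h.symm, zero_mul]
  rcases eq_or_lt_of_le hy.2 with h' | h'
  · rw [hb h', zero_mul]
  have hn : Icc a b ∈ 𝓝 y := Icc_mem_nhds h h'
  have : IsLocalMax φ y := Filter.eventually_of_mem hn hmax
  rw [this.hasDerivAt_eq_zero (hφ.hasDerivAt hn), mul_zero]

/-- At a spatial maximum both terms of `u·∇f` vanish, so `∂ₜf ≤ M` there and the maximum principle
applies. The case `a = b` is allowed and gives transport along a single axis. -/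
theorem le_of_transport (hT : 0 < T) {f : ℝ → ℝ → ℝ → ℝ} (hf : Smooth3 T f) {a b B M t : ℝ}
    (ht : t ∈ timeInterval T) (hu : ∀ s ∈ Icc 0 t, TangentFlow (u₁ s) (u₂ s))
    (hu₁ : ∀ s ∈ Icc 0 t, ∀ y ∈ Icc 0 Real.pi, u₁ s a y = 0 ∧ u₁ s b y = 0)
    (h0 : ∀ x ∈ Icc a b, ∀ y ∈ Icc 0 Real.pi, f 0 x y ≤ B)
    (hM : ∀ s ∈ Icc 0 t, ∀ x ∈ Icc a b, ∀ y ∈ Icc 0 Real.pi,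
      dt T f s x y ≤ -adv (u₁ s) (u₂ s) (f s) x y + M) :
    ∀ x ∈ Icc a b, ∀ y ∈ Icc 0 Real.pi, f t x y ≤ B + M * t := by
  intro x hx y hy
  refine le_add_mul_of_dt_le_at_max (isCompact_rect a b) (f := fun s z => f s z.1 z.2)
    (f' := fun s z => dt T f s z.1 z.2) ht.1 (hf.continuousOn ht a b) (fun s hs z hz => ?_)
    (fun z hz => h0 z.1 hz.1 z.2 hz.2) (fun s hs z hz hmax => ?_) t ⟨ht.1, le_rfl⟩ (x, y) ⟨hx, hy⟩
  · exact (hf.hasDerivWithinAt hT (Icc_subset_timeInterval ht hs) z.1 hz.2).mono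
      (Icc_subset_timeInterval ht)
  · obtain ⟨x, y⟩ := z
    obtain ⟨hx, hy⟩ := hz
    have hs' := hf.slice (Icc_subset_timeInterval ht hs)
    have e1 : u₁ s x y * d1 (f s) x y = 0 :=
      mul_deriv_eq_zero_of_isMax hx (hs'.hasDerivAt x hy).hasDerivWithinAt
        (fun z hz => hmax (z, y) ⟨hz, hy⟩) (fun h => by rw [show x = a from h]; exact (hu₁ s hs y hy).1)
        (fun h => by rw [show x = b from h]; exact (hu₁ s hs y hy).2)
    have e2 : u₂ s x y * d2 (f s) x y = 0 :=
      mul_deriv_eq_zero_of_isMax hy (hs'.hasDerivWithinAt x hy)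
        (fun z hz => hmax (x, z) ⟨hx, hz⟩) (fun h => by rw [show y = 0 from h]; exact (hu s hs).bottom x)
        (fun h => by rw [show y = Real.pi from h]; exact (hu s hs).top x)
    have := hM s hs x hx y hy
    simp only [adv, Pi.add_apply, Pi.mul_apply, e1, e2] at this
    simpa using this

theorem adv_neg (u₁ u₂ f : ℝ → ℝ → ℝ) (x y : ℝ) : adv u₁ u₂ (-f) x y = -adv u₁ u₂ f x y := by
  simp only [adv, Pi.add_apply, Pi.mul_apply, d1_neg, d2_neg]; ring

theorem dt_neg (f : ℝ → ℝ → ℝ → ℝ) (t x y : ℝ) : dt T (-f) t x y = -dt T f t x y :=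
  derivWithin.fun_neg

theorem Smooth3.neg {f : ℝ → ℝ → ℝ → ℝ} (hf : Smooth3 T f) : Smooth3 T (-f) := ContDiffOn.neg hf

namespace IsSmoothSolution

theorem flow (h : IsSmoothSolution T ρ₀ ω₀ ρ ω u₁ u₂) {t : ℝ} (ht : t ∈ timeInterval T) :
    TangentFlow (u₁ t) (u₂ t) :=
  let ⟨_, hψ⟩ := h.exists_isStream ht
  hψ.flow

theorem density_le (hT : 0 < T) (h : IsSmoothSolution T ρ₀ ω₀ ρ ω u₁ u₂) {a b B t : ℝ}
    (ht : t ∈ timeInterval T)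
    (hu₁ : ∀ s ∈ Icc 0 t, ∀ y ∈ Icc 0 Real.pi, u₁ s a y = 0 ∧ u₁ s b y = 0)
    (h0 : ∀ x ∈ Icc a b, ∀ y ∈ Icc 0 Real.pi, ρ₀ x y ≤ B) :
    ∀ x ∈ Icc a b, ∀ y ∈ Icc 0 Real.pi, ρ t x y ≤ B := by
  have := le_of_transport (M := 0) (B := B) hT h.smooth_density.smooth ht
    (fun s hs => h.flow (Icc_subset_timeInterval ht hs)) hu₁
    (fun x hx y hy => by rw [h.initial_density x y hy]; exact h0 x hx y hy)
    (fun s hs x _ y hy => by rw [h.dt_density (Icc_subset_timeInterval ht hs) x hy, add_zero])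
  simpa using this

theorem le_density (hT : 0 < T) (h : IsSmoothSolution T ρ₀ ω₀ ρ ω u₁ u₂) {a b B t : ℝ}
    (ht : t ∈ timeInterval T)
    (hu₁ : ∀ s ∈ Icc 0 t, ∀ y ∈ Icc 0 Real.pi, u₁ s a y = 0 ∧ u₁ s b y = 0)
    (h0 : ∀ x ∈ Icc a b, ∀ y ∈ Icc 0 Real.pi, B ≤ ρ₀ x y) :
    ∀ x ∈ Icc a b, ∀ y ∈ Icc 0 Real.pi, B ≤ ρ t x y := by
  have := le_of_transport (M := 0) (B := -B) hT (Smooth3.neg h.smooth_density.smooth) ht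
    (fun s hs => h.flow (Icc_subset_timeInterval ht hs)) hu₁
    (fun x hx y hy => by
      rw [Pi.neg_apply, Pi.neg_apply, Pi.neg_apply, h.initial_density x y hy]
      exact neg_le_neg (h0 x hx y hy))
    (fun s hs x _ y hy => by
      rw [dt_neg, Pi.neg_apply, adv_neg, h.dt_density (Icc_subset_timeInterval ht hs) x hy,
        add_zero])
  intro x hx y hy
  simpa using this x hx y hy

theorem abs_vorticity_le (hT : 0 < T) (h : IsSmoothSolution T ρ₀ ω₀ ρ ω u₁ u₂) {a b B M t : ℝ}
    (ht : t ∈ timeInterval T)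
    (hu₁ : ∀ s ∈ Icc 0 t, ∀ y ∈ Icc 0 Real.pi, u₁ s a y = 0 ∧ u₁ s b y = 0)
    (h0 : ∀ x ∈ Icc a b, ∀ y ∈ Icc 0 Real.pi, |ω₀ x y| ≤ B)
    (hM : ∀ s ∈ Icc 0 t, ∀ x ∈ Icc a b, ∀ y ∈ Icc 0 Real.pi, |d1 (ρ s) x y| ≤ M) :
    ∀ x ∈ Icc a b, ∀ y ∈ Icc 0 Real.pi, |ω t x y| ≤ B + M * t := by
  have h1 := le_of_transport (M := M) (B := B) hT h.smooth_vorticity.smooth ht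
    (fun s hs => h.flow (Icc_subset_timeInterval ht hs)) hu₁
    (fun x hx y hy => by
      rw [h.initial_vorticity x y hy]; exact (abs_le.1 (h0 x hx y hy)).2)
    (fun s hs x hx y hy => by
      rw [h.dt_vorticity (Icc_subset_timeInterval ht hs) x hy]
      linarith [(abs_le.1 (hM s hs x hx y hy)).1])
  have h2 := le_of_transport (M := M) (B := B) hT (Smooth3.neg h.smooth_vorticity.smooth) ht
    (fun s hs => h.flow (Icc_subset_timeInterval ht hs)) hu₁
    (fun x hx y hy => by
      rw [Pi.neg_apply, Pi.neg_apply, Pi.neg_apply, h.initial_vorticity x y hy]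
      linarith [(abs_le.1 (h0 x hx y hy)).1])
    (fun s hs x hx y hy => by
      rw [dt_neg, Pi.neg_apply, adv_neg, h.dt_vorticity (Icc_subset_timeInterval ht hs) x hy]
      linarith [(abs_le.1 (hM s hs x hx y hy)).2])
  intro x hx y hy
  have h3 := h2 x hx y hy
  simp only [Pi.neg_apply] at h3
  exact abs_le.2 ⟨by linarith, h1 x hx y hy⟩

/-! ### Growth of the circulation and conservation of energy on `[0, π] × [0, π]` -/

/-- The flow is tangent to all sides of the square, so advection integrates to zero, and `-∂₁ρ`
integrates to the density gap between the two axes. -/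
theorem rectInt_vorticity_ge (hT : 0 < T) (h : IsSmoothSolution T ρ₀ ω₀ ρ ω u₁ u₂) {k t : ℝ}
    (ht : t ∈ timeInterval T)
    (hu₁ : ∀ s ∈ Icc 0 t, ∀ y ∈ Icc 0 Real.pi, u₁ s 0 y = 0 ∧ u₁ s Real.pi y = 0)
    (hk : ∀ s ∈ Icc 0 t, ∀ y ∈ Icc 0 Real.pi, k ≤ ρ s 0 y - ρ s Real.pi y) :
    rectInt 0 Real.pi ω₀ + k * Real.pi * t ≤ rectInt 0 Real.pi (ω t) := by
  have hpi := Real.pi_pos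
  have sω : Smooth3 T ω := h.smooth_vorticity.smooth
  -- Spatially constant with integral `k π t` over the square, so the claim becomes that the
  -- integral of `q - ω` does not increase.
  set q : ℝ → ℝ → ℝ → ℝ := fun t _ _ => k / Real.pi * t with hq
  have sq : Smooth3 T q := smooth3_time (φ := fun t => k / Real.pi * t) (by fun_prop)
  have key := rectInt_le_of_dt_nonpos (a := 0) (b := Real.pi) hT (sq.sub sω) ht fun s hs => by
    have hs' := Icc_subset_timeInterval ht hs
    have sρ : Smooth2 (ρ s) := Smooth3.slice h.smooth_density.smooth hs'
    have sωs : Smooth2 (ω s) := sω.slice hs'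
    have hfl := h.flow hs'
    have sA := hfl.smooth₁.adv hfl.smooth₂ sωs
    have e1 : HasDerivAt (fun t => k / Real.pi * t) (k / Real.pi) s := by
      simpa using (hasDerivAt_id s).const_mul (k / Real.pi)
    rw [rectInt_congr (g := ((fun _ _ => k / Real.pi) + d1 (ρ s)) + adv (u₁ s) (u₂ s) (ω s))
      fun x _ y hy => ?_, rectInt_add ((smooth2_const _).add sρ.d1) sA,
      rectInt_add (smooth2_const _) sρ.d1, rectInt_const hpi.le, rectInt_d1 hpi.le sρ,
      hfl.rectInt_adv hpi.le sωs fun y hy => by rw [(hu₁ s hs y hy).1, (hu₁ s hs y hy).2]; simp]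
    · have : ∫ y in Icc 0 Real.pi, (ρ s Real.pi y - ρ s 0 y) ≤ ∫ y in Icc 0 Real.pi, -k := by
        refine setIntegral_mono_on ?_ (integrableOn_const (by simp)) measurableSet_Icc
          fun y hy => by linarith [hk s hs y hy]
        exact ((sρ.continuousOn_snd _).sub (sρ.continuousOn_snd _)).integrableOn_compact
          isCompact_Icc
      rw [setIntegral_const] at this
      simp [hpi.le] at this
      have e : (Real.pi - 0) * Real.pi * (k / Real.pi) = Real.pi * k := by field_simp; ring
      rw [e]; linarith
    · rw [sq.dt_sub hT sω hs' x hy, hq, dt_time hT e1 hs', h.dt_vorticity hs' x hy]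
      simp only [Pi.add_apply]; ring
  have e : ∀ s ∈ timeInterval T, rectInt 0 Real.pi ((q - ω) s)
      = k * Real.pi * s - rectInt 0 Real.pi (ω s) := fun s hs => by
    rw [Pi.sub_apply, rectInt_sub (sq.slice hs) (sω.slice hs), hq, rectInt_const hpi.le]
    field_simp; ring
  rw [e t ht, e 0 (zero_mem_timeInterval hT),
    rectInt_congr (f := ω 0) (fun x _ y hy => h.initial_vorticity x y hy)] at key
  linarith

/-- Along a vertical line `∂₂ψ = u₁ = 0`, and `ψ` vanishes at the bottom. Hence `ψ` vanishes on the
whole boundary of the square, which removes the boundary terms in the energy identity. -/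
theorem _root_.BoussinesqStrip.IsStream.eq_zero_of_velocity {ψ ω u₁ u₂ : ℝ → ℝ → ℝ}
    (hψ : IsStream ψ ω u₁ u₂) {x : ℝ} (hx : ∀ y ∈ Icc 0 Real.pi, u₁ x y = 0) {y : ℝ}
    (hy : y ∈ Icc 0 Real.pi) : ψ x y = 0 := by
  rw [constant_of_derivWithin_zero (f := fun y => ψ x y)
    (fun y hy => (hψ.smooth.hasDerivWithinAt x hy).differentiableWithinAt)
    (fun y hy => ?_) y hy, hψ.bottom]
  have hy' := Ico_subset_Icc_self hy
  exact (hψ.d2_eq x y hy').trans (hx y hy')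

/-- Buoyancy changes `∫ |u|²` at rate `-2 ∫ u₂ ρ`, and `∫ 2 x₂ ρ` changes at the opposite rate. By
the maximum principle the potential term is at most `2 π³ R` in absolute value at each of the two
times. -/
theorem energy_le (hT : 0 < T) (h : IsSmoothSolution T ρ₀ ω₀ ρ ω u₁ u₂) {t R : ℝ}
    (ht : t ∈ timeInterval T)
    (hu₁ : ∀ s ∈ Icc 0 t, ∀ y ∈ Icc 0 Real.pi, u₁ s 0 y = 0 ∧ u₁ s Real.pi y = 0)
    (hR : ∀ x ∈ Icc 0 Real.pi, ∀ y ∈ Icc 0 Real.pi, |ρ₀ x y| ≤ R) :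
    rectInt 0 Real.pi (u₁ t * u₁ t + u₂ t * u₂ t)
      ≤ rectInt 0 Real.pi (u₁ 0 * u₁ 0 + u₂ 0 * u₂ 0) + 4 * Real.pi ^ 3 * R := by
  have hpi := Real.pi_pos
  have i0 := zero_mem_timeInterval hT
  have sρ : Smooth3 T ρ := h.smooth_density.smooth
  have sω : Smooth3 T ω := h.smooth_vorticity.smooth
  have su₁ : Smooth3 T u₁ := h.smooth_velocity₁.smooth
  have su₂ : Smooth3 T u₂ := h.smooth_velocity₂.smooth
  set Y : ℝ → ℝ → ℝ → ℝ := fun _ _ y => 2 * y with hY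
  set Y2 : ℝ → ℝ → ℝ := fun _ y => 2 * y with hY2
  have sY : Smooth3 T Y := smooth3_snd (φ := fun y => 2 * y) (by fun_prop)
  have sY2 : Smooth2 Y2 := smooth2_snd (φ := fun y => 2 * y) (by fun_prop)
  have dY1 : ∀ x y, d1 Y2 x y = 0 := fun x y => d1_const_fun _ x y
  have dY2 : ∀ x, ∀ y ∈ Icc 0 Real.pi, d2 Y2 x y = 2 := fun x y hy =>
    d2_fun (by simpa using (hasDerivAt_id y).const_mul 2) hy x
  have key := rectInt_le_of_dt_nonpos (a := 0) (b := Real.pi) hT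
    (((su₁.mul su₁).add (su₂.mul su₂)).add (sY.mul sρ)) ht fun s hs => by
      have hs' := Icc_subset_timeInterval ht hs
      obtain ⟨ψ, hψ⟩ := h.exists_isStream hs'
      have ρ2 : Smooth2 (ρ s) := sρ.slice hs'
      have ω2 : Smooth2 (ω s) := sω.slice hs'
      have f1 := hψ.flow.smooth₁
      have f2 := hψ.flow.smooth₂
      have d₁ := (su₁.dt hT).slice hs'
      have d₂ := (su₂.dt hT).slice hs'
      have z0 : ∀ y ∈ Icc 0 Real.pi, ψ 0 y = 0 := fun y hy =>
        hψ.eq_zero_of_velocity (fun y hy => (hu₁ s hs y hy).1) hy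
      have zp : ∀ y ∈ Icc 0 Real.pi, ψ Real.pi y = 0 := fun y hy =>
        hψ.eq_zero_of_velocity (fun y hy => (hu₁ s hs y hy).2) hy
      have k1 : rectInt 0 Real.pi (u₁ s * dt T u₁ s + u₂ s * dt T u₂ s)
          = -rectInt 0 Real.pi (u₂ s * ρ s) := by
        have sA := f1.adv f2 ω2
        rw [hψ.rectInt_dot hpi.le d₁ d₂ (fun y hy => by rw [z0 y hy, zp y hy]; simp),
          rectInt_congr (g := -(ψ * d1 (ρ s)) - ψ * adv (u₁ s) (u₂ s) (ω s))
            fun x _ y hy => ?_,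
          rectInt_sub (hψ.smooth.mul ρ2.d1).neg (hψ.smooth.mul sA), rectInt_neg,
          rectInt_mul_d1 hpi.le hψ.smooth ρ2 (fun y hy => by rw [z0 y hy, zp y hy]; simp),
          hψ.rectInt_mul_adv_self hpi.le ω2 (fun y hy => by rw [z0 y hy, zp y hy]; simp),
          neg_neg, sub_zero, ← rectInt_neg]
        · refine rectInt_congr fun x _ y hy => ?_
          simp [hψ.d1_eq x y hy]
        · have e := curl_dt_eq hT su₁ su₂ (fun t ht x y hy => by
            obtain ⟨ψ, hψ⟩ := h.exists_isStream ht
            exact hψ.curl_eq x y hy) hs' x hy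
          rw [h.dt_vorticity hs' x hy] at e
          simp only [Pi.mul_apply, Pi.sub_apply, Pi.neg_apply]
          linear_combination ψ x y * e
      have k2 : rectInt 0 Real.pi (Y2 * dt T ρ s) = 2 * rectInt 0 Real.pi (u₂ s * ρ s) := by
        rw [rectInt_congr (g := -(Y2 * adv (u₁ s) (u₂ s) (ρ s))) fun x _ y hy => ?_, rectInt_neg,
          hψ.flow.rectInt_mul_adv hpi.le sY2 ρ2
            (fun y hy => by rw [(hu₁ s hs y hy).1, (hu₁ s hs y hy).2]; simp), neg_neg,
          ← rectInt_const_mul]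
        · refine rectInt_congr fun x _ y hy => ?_
          simp only [adv, Pi.mul_apply, Pi.add_apply, dY1, dY2 x y hy]; ring
        · simp only [Pi.mul_apply, Pi.neg_apply, h.dt_density hs' x hy]; ring
      have k3 : rectInt 0 Real.pi (dt T (u₁ * u₁ + u₂ * u₂ + Y * ρ) s)
          = 2 * rectInt 0 Real.pi (u₁ s * dt T u₁ s + u₂ s * dt T u₂ s)
            + rectInt 0 Real.pi (Y2 * dt T ρ s) := by
        have se := (f1.mul d₁).add (f2.mul d₂)
        rw [← rectInt_const_mul, ← rectInt_add (f := fun x y => 2 * (u₁ s * dt T u₁ s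
          + u₂ s * dt T u₂ s) x y) ((smooth2_const 2).mul se) (sY2.mul ((sρ.dt hT).slice hs'))]
        refine rectInt_congr fun x _ y hy => ?_
        rw [((su₁.mul su₁).add (su₂.mul su₂)).dt_add hT (sY.mul sρ) hs' x hy,
          (su₁.mul su₁).dt_add hT (su₂.mul su₂) hs' x hy, su₁.dt_mul hT su₁ hs' x hy,
          su₂.dt_mul hT su₂ hs' x hy, sY.dt_mul hT sρ hs' x hy, hY, dt_snd]
        simp only [Pi.mul_apply, Pi.add_apply, hY2]; ring
      rw [k3, k1, k2]; linarith
  have split : ∀ s ∈ timeInterval T, rectInt 0 Real.pi ((u₁ * u₁ + u₂ * u₂ + Y * ρ) s)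
      = rectInt 0 Real.pi (u₁ s * u₁ s + u₂ s * u₂ s) + rectInt 0 Real.pi (Y2 * ρ s) :=
    fun s hs => rectInt_add
      (((su₁.slice hs).mul (su₁.slice hs)).add ((su₂.slice hs).mul (su₂.slice hs)))
      (sY2.mul (sρ.slice hs))
  have bound : ∀ s ∈ Icc 0 t, |rectInt 0 Real.pi (Y2 * ρ s)| ≤ 2 * Real.pi ^ 3 * R := by
    intro s hs
    have hs' := Icc_subset_timeInterval ht hs
    have hu := fun r (hr : r ∈ Icc 0 s) => hu₁ r ⟨hr.1, hr.2.trans hs.2⟩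
    have b1 := h.density_le hT hs' hu (fun x hx y hy => (abs_le.1 (hR x hx y hy)).2)
    have b2 := h.le_density hT hs' hu (fun x hx y hy => (abs_le.1 (hR x hx y hy)).1)
    have hR0 : 0 ≤ R := (abs_nonneg _).trans (hR 0 zero_mem_Icc_pi 0 zero_mem_Icc_pi)
    have sm := sY2.mul (sρ.slice hs')
    have m1 := rectInt_mono (a := 0) (b := Real.pi) sm (smooth2_const (2 * Real.pi * R))
      fun x hx y hy => by
        have := b1 x hx y hy
        have := mul_le_mul_of_nonneg_left this hy.1
        have := mul_le_mul_of_nonneg_right hy.2 hR0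
        simp only [Pi.mul_apply, hY2]; linarith
    have m2 := rectInt_mono (a := 0) (b := Real.pi) (smooth2_const (-(2 * Real.pi * R))) sm
      fun x hx y hy => by
        have := b2 x hx y hy
        have := mul_le_mul_of_nonneg_left this hy.1
        have := mul_le_mul_of_nonneg_right hy.2 hR0
        simp only [Pi.mul_apply, hY2]; linarith
    rw [rectInt_const hpi.le] at m1 m2
    exact abs_le.2 ⟨by linarith, by linarith⟩
  rw [split t ht, split 0 i0] at key
  have b1 := abs_le.1 (bound t ⟨ht.1, le_rfl⟩)
  have b2 := abs_le.1 (bound 0 ⟨le_rfl, ht.1⟩)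
  linarith [b1.1, b2.2]

end IsSmoothSolution

end BoussinesqStrip

namespace BoussinesqStrip

/-! ### `L^p` norms -/

theorem enorm_le_stripLpNorm_top {f : ℝ → ℝ → ℝ}
    (hf : ContinuousOn (fun z : ℝ × ℝ => f z.1 z.2) (Ioc (-Real.pi) Real.pi ×ˢ Icc 0 Real.pi))
    {x y : ℝ} (hx : x ∈ Ioc (-Real.pi) Real.pi) (hy : y ∈ Icc 0 Real.pi) :
    ENNReal.ofReal |f x y| ≤ stripLpNorm ⊤ f := by
  set M := stripLpNorm ⊤ f with hM
  rcases eq_or_ne M ⊤ with h | h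
  · rw [h]; exact le_top
  set D : Set (ℝ × ℝ) := Ioc (-Real.pi) Real.pi ×ˢ Icc 0 Real.pi
  have hint : interior D = Ioo (-Real.pi) Real.pi ×ˢ Ioo 0 Real.pi := by
    rw [interior_prod_eq, interior_Ioc, interior_Icc]
  have hcl : D ⊆ closure (interior D) := by
    rw [hint, closure_prod_eq, closure_Ioo neg_pi_lt_pi.ne, closure_Ioo Real.pi_pos.ne]
    exact prod_mono Ioc_subset_Icc_self subset_rfl
  -- Rewriting `|f| ≤ M` as `max |f| M = M` turns an a.e. inequality into an a.e. equality of
  -- continuous functions, which then holds everywhere on `D`.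
  have hae : (fun z : ℝ × ℝ => max |f z.1 z.2| M.toReal) =ᵐ[volume.restrict D]
      fun _ => M.toReal := by
    filter_upwards [enorm_ae_le_eLpNormEssSup (fun z : ℝ × ℝ => f z.1 z.2) (volume.restrict D)]
      with z hz
    refine max_eq_right ?_
    rw [← eLpNorm_exponent_top] at hz
    change ‖f z.1 z.2‖ₑ ≤ M at hz
    rw [← Real.norm_eq_abs, ← toReal_enorm]
    exact ENNReal.toReal_mono h hz
  have := Measure.eqOn_of_ae_eq hae (hf.abs.sup continuousOn_const) continuousOn_const hcl
    (x := (x, y)) ⟨hx, hy⟩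
  exact (ENNReal.ofReal_le_iff_le_toReal h).2 (max_eq_right_iff.1 this)

theorem Icc_zero_pi_subset : Icc 0 Real.pi ⊆ Ioc (-Real.pi) Real.pi := fun x hx =>
  ⟨by linarith [hx.1, Real.pi_pos], hx.2⟩

theorem Smooth2.continuousOn_Ioc {f : ℝ → ℝ → ℝ} (hf : Smooth2 f) :
    ContinuousOn (fun z : ℝ × ℝ => f z.1 z.2) (Ioc (-Real.pi) Real.pi ×ˢ Icc 0 Real.pi) :=
  (ContDiffOn.continuousOn hf).mono (prod_mono (subset_univ _) subset_rfl)

theorem abs_le_stripLpNorm_vecLength {v₁ v₂ : ℝ → ℝ → ℝ} (h₁ : Smooth2 v₁) (h₂ : Smooth2 v₂)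
    {x y : ℝ} (hx : x ∈ Icc 0 Real.pi) (hy : y ∈ Icc 0 Real.pi) :
    ENNReal.ofReal |v₁ x y| ≤ stripLpNorm ⊤ (vecLength v₁ v₂) ∧
      ENNReal.ofReal |v₂ x y| ≤ stripLpNorm ⊤ (vecLength v₁ v₂) := by
  have hc : ContinuousOn (fun z : ℝ × ℝ => vecLength v₁ v₂ z.1 z.2)
      (Ioc (-Real.pi) Real.pi ×ˢ Icc 0 Real.pi) :=
    ((h₁.continuousOn_Ioc.pow 2).add (h₂.continuousOn_Ioc.pow 2)).sqrt
  have key := enorm_le_stripLpNorm_top hc (Icc_zero_pi_subset hx) hy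
  rw [abs_of_nonneg (show 0 ≤ vecLength v₁ v₂ x y from Real.sqrt_nonneg _)] at key
  refine ⟨le_trans (ENNReal.ofReal_le_ofReal ?_) key, le_trans (ENNReal.ofReal_le_ofReal ?_) key⟩
  · exact Real.abs_le_sqrt (by linarith [sq_nonneg (v₂ x y)])
  · exact Real.abs_le_sqrt (by linarith [sq_nonneg (v₁ x y)])

/-- Because `χ ^ q ≤ χ` for values in `[0, 1]`. Writing the exponent as `(q⁻¹).toReal` includes `q =
∞`, where the right side is `1`. -/
theorem eLpNorm_le_rpow_of_le_one {α : Type*} [MeasurableSpace α] {μ : Measure α} {χ : α → ℝ}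
    (h0 : ∀ᵐ z ∂μ, 0 ≤ χ z) (h1 : ∀ᵐ z ∂μ, χ z ≤ 1) (hi : Integrable χ μ) {q : ENNReal}
    (hq : 1 ≤ q) :
    eLpNorm χ q μ ≤ ENNReal.ofReal (∫ z, χ z ∂μ) ^ (q⁻¹).toReal := by
  have he : ∀ᵐ z ∂μ, ‖χ z‖ₑ ≤ 1 := by
    filter_upwards [h0, h1] with z hz hz'
    rw [Real.enorm_eq_ofReal hz]
    exact ENNReal.ofReal_le_one.2 hz'
  rcases eq_or_ne q ⊤ with rfl | hqt
  · rw [eLpNorm_exponent_top, ENNReal.inv_top, ENNReal.toReal_zero, ENNReal.rpow_zero]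
    exact essSup_le_of_ae_le 1 he
  have hq1 : 1 ≤ q.toReal := by simpa using ENNReal.toReal_mono hqt hq
  rw [eLpNorm_eq_lintegral_rpow_enorm_toReal (by positivity) hqt, ENNReal.toReal_inv, one_div,
    ofReal_integral_eq_lintegral_ofReal hi h0]
  gcongr ?_ ^ _
  refine lintegral_mono_ae ?_
  filter_upwards [h0, he] with z hz hz'
  rw [← Real.enorm_eq_ofReal hz]
  calc ‖χ z‖ₑ ^ q.toReal ≤ ‖χ z‖ₑ ^ (1 : ℝ) := ENNReal.rpow_le_rpow_of_exponent_ge hz' hq1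
    _ = _ := ENNReal.rpow_one _

/-- Hölder's inequality against a function with values in `[0, 1]`. -/
theorem ofReal_integral_mul_le {α : Type*} [MeasurableSpace α] {μ : Measure α} {f χ : α → ℝ}
    (hf : AEStronglyMeasurable f μ) (h0 : ∀ᵐ z ∂μ, 0 ≤ χ z) (h1 : ∀ᵐ z ∂μ, χ z ≤ 1)
    (hi : Integrable χ μ) {δ : ℝ} (hδ : ∫ z, χ z ∂μ ≤ δ) {p : ENNReal} (hp : 1 ≤ p) :
    ENNReal.ofReal (∫ z, χ z * f z ∂μ)
      ≤ ENNReal.ofReal δ ^ (1 - (p⁻¹).toReal) * eLpNorm f p μ := by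
  have hp1 : p⁻¹ ≤ 1 := ENNReal.inv_le_one.2 hp
  -- The conjugate exponent; inversion in `ENNReal` treats the endpoints `p = 1` and `p = ∞`
  -- uniformly.
  set q : ENNReal := (1 - p⁻¹)⁻¹ with hqdef
  have hq : 1 ≤ q := ENNReal.one_le_inv.2 tsub_le_self
  have hqi : (q⁻¹).toReal = 1 - (p⁻¹).toReal := by
    rw [hqdef, inv_inv, ENNReal.toReal_sub_of_le hp1 (by simp)]; simp
  have : ENNReal.HolderConjugate q p :=
    ENNReal.holderConjugate_iff.2 (by rw [hqdef, inv_inv, tsub_add_cancel_of_le hp1])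
  calc ENNReal.ofReal (∫ z, χ z * f z ∂μ) ≤ ‖∫ z, χ z * f z ∂μ‖ₑ := Real.ofReal_le_enorm _
    _ ≤ ∫⁻ z, ‖χ z * f z‖ₑ ∂μ := enorm_integral_le_lintegral_enorm _
    _ = eLpNorm (χ • f) 1 μ := by rw [eLpNorm_one_eq_lintegral_enorm]; rfl
    _ ≤ eLpNorm χ q μ * eLpNorm f p μ := eLpNorm_smul_le_mul_eLpNorm hf hi.1
    _ ≤ _ := by
      gcongr
      refine (eLpNorm_le_rpow_of_le_one h0 h1 hi hq).trans ?_
      rw [hqi]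
      refine ENNReal.rpow_le_rpow (ENNReal.ofReal_le_ofReal hδ) ?_
      rw [← hqi]; exact ENNReal.toReal_nonneg

/-! ### A cutoff function -/

theorem rectInt_fst {Φ φ : ℝ → ℝ} (hφ : ContDiff ℝ (⊤ : ℕ∞) Φ) (h : ∀ x, HasDerivAt Φ (φ x) x)
    {a b : ℝ} (hab : a ≤ b) :
    rectInt a b (fun x _ => φ x) = Real.pi * (Φ b - Φ a) := by
  rw [rectInt_congr (g := d1 (fun x _ => Φ x)) fun x _ y _ => (d1_fun (h x) y).symm,
    rectInt_d1 hab (smooth2_fst hφ), setIntegral_const]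
  simp [Real.pi_pos.le]

theorem rectInt_snd {Φ φ : ℝ → ℝ} (hφ : ContDiff ℝ (⊤ : ℕ∞) Φ) (h : ∀ x, HasDerivAt Φ (φ x) x)
    {a b : ℝ} (hab : a ≤ b) :
    rectInt a b (fun _ y => φ y) = (b - a) * (Φ Real.pi - Φ 0) := by
  rw [rectInt_congr (g := d2 (fun _ y => Φ y)) fun x _ y hy => (d2_fun (h y) hy x).symm,
    rectInt_d2 (smooth2_snd hφ), setIntegral_const]
  simp [hab]

/-- The sum of two boundary layers of width `1 / c`. -/
noncomputable def layer (c s : ℝ) : ℝ := Real.exp (-c * s) + Real.exp (-c * (Real.pi - s))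

/-- An antiderivative of `layer c`. -/
noncomputable def layerInt (c s : ℝ) : ℝ :=
  c⁻¹ * (Real.exp (-c * (Real.pi - s)) - Real.exp (-c * s))

theorem contDiff_layerInt (c : ℝ) : ContDiff ℝ (⊤ : ℕ∞) (layerInt c) := by
  unfold layerInt; fun_prop

theorem contDiff_layer (c : ℝ) : ContDiff ℝ (⊤ : ℕ∞) (layer c) := by
  unfold layer; fun_prop

theorem hasDerivAt_exp_left (c s : ℝ) :
    HasDerivAt (fun s => Real.exp (-c * s)) (-c * Real.exp (-c * s)) s := by
  have := ((hasDerivAt_id s).const_mul (-c)).exp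
  simpa [mul_comm] using this

theorem hasDerivAt_exp_right (c s : ℝ) :
    HasDerivAt (fun s => Real.exp (-c * (Real.pi - s))) (c * Real.exp (-c * (Real.pi - s))) s := by
  have := (((hasDerivAt_id s).const_sub Real.pi).const_mul (-c)).exp
  simpa [mul_comm] using this

theorem hasDerivAt_layerInt {c : ℝ} (hc : 0 < c) (s : ℝ) :
    HasDerivAt (layerInt c) (layer c s) s := by
  refine (((hasDerivAt_exp_right c s).sub (hasDerivAt_exp_left c s)).const_mul c⁻¹).congr_deriv ?_
  unfold layer; field_simp; ring

theorem layerInt_sub_le {c : ℝ} (hc : 0 < c) : layerInt c Real.pi - layerInt c 0 ≤ 2 / c := by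
  have h := Real.exp_pos (-c * Real.pi)
  unfold layerInt
  rw [← mul_sub, inv_mul_eq_div]
  gcongr
  simp only [sub_self, mul_zero, Real.exp_zero, sub_zero]
  linarith

theorem rectInt_layer_le {c : ℝ} (hc : 0 < c) :
    rectInt 0 Real.pi (fun x _ => layer c x) ≤ 2 * Real.pi / c ∧
      rectInt 0 Real.pi (fun _ y => layer c y) ≤ 2 * Real.pi / c := by
  have h := mul_le_mul_of_nonneg_left (layerInt_sub_le hc) Real.pi_pos.le
  rw [rectInt_fst (contDiff_layerInt c) (hasDerivAt_layerInt hc) Real.pi_pos.le,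
    rectInt_snd (contDiff_layerInt c) (hasDerivAt_layerInt hc) Real.pi_pos.le, sub_zero]
  have e : Real.pi * (2 / c) = 2 * Real.pi / c := by ring
  rw [e] at h
  exact ⟨h, h⟩

/-- A smooth cutoff that vanishes at `0` and `π`, with boundary layers of width `1 / c`. -/
noncomputable def bump (c s : ℝ) : ℝ :=
  (1 - Real.exp (-c * s)) * (1 - Real.exp (-c * (Real.pi - s)))

/-- The derivative of `bump c`. -/
noncomputable def bumpDeriv (c s : ℝ) : ℝ :=
  c * Real.exp (-c * s) * (1 - Real.exp (-c * (Real.pi - s)))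
    - (1 - Real.exp (-c * s)) * (c * Real.exp (-c * (Real.pi - s)))

theorem contDiff_bump (c : ℝ) : ContDiff ℝ (⊤ : ℕ∞) (bump c) := by unfold bump; fun_prop

theorem hasDerivAt_bump (c s : ℝ) : HasDerivAt (bump c) (bumpDeriv c s) s := by
  refine (((hasDerivAt_exp_left c s).const_sub 1).mul
    ((hasDerivAt_exp_right c s).const_sub 1)).congr_deriv ?_
  unfold bumpDeriv; ring

theorem bump_zero (c : ℝ) : bump c 0 = 0 := by simp [bump]
theorem bump_pi (c : ℝ) : bump c Real.pi = 0 := by simp [bump]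

/-- With `a = exp (-c s)` and `b = exp (-c (π - s))`, the bump is `(1 - a)(1 - b)`, its complement
is `a + b - a b`, and its derivative is `c (a - b)`. -/
theorem bump_bounds {c s : ℝ} (hc : 0 < c) (hs : s ∈ Icc 0 Real.pi) :
    0 ≤ bump c s ∧ bump c s ≤ 1 ∧ 1 - bump c s ≤ layer c s ∧
      bumpDeriv c s ^ 2 ≤ c ^ 2 * layer (2 * c) s := by
  have p1 := Real.exp_pos (-c * s)
  have p2 := Real.exp_pos (-c * (Real.pi - s))
  have l1 : Real.exp (-c * s) ≤ 1 := Real.exp_le_one_iff.2 (by nlinarith [hs.1])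
  have l2 : Real.exp (-c * (Real.pi - s)) ≤ 1 := Real.exp_le_one_iff.2 (by nlinarith [hs.2])
  have s1 : Real.exp (-(2 * c) * s) = Real.exp (-c * s) ^ 2 := by
    rw [← Real.exp_nat_mul]; congr 1; push_cast; ring
  have s2 : Real.exp (-(2 * c) * (Real.pi - s)) = Real.exp (-c * (Real.pi - s)) ^ 2 := by
    rw [← Real.exp_nat_mul]; congr 1; push_cast; ring
  unfold bump bumpDeriv layer
  rw [s1, s2]
  generalize Real.exp (-c * s) = a at *
  generalize Real.exp (-c * (Real.pi - s)) = b at *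
  refine ⟨mul_nonneg (by linarith) (by linarith), by nlinarith, by nlinarith, ?_⟩
  have e : (c * a * (1 - b) - (1 - a) * (c * b)) ^ 2 = c ^ 2 * (a - b) ^ 2 := by ring
  rw [e]
  gcongr
  nlinarith

/-- A product of one-dimensional bumps. The complement is bounded by the sum of two layers of width
of order `1 / c`; each partial derivative has size of order `c` on such a layer, so its square
integrates to order `c`. -/
theorem exists_cutoff {c : ℝ} (hc : 0 < c) : ∃ φ : ℝ → ℝ → ℝ, Smooth2 φ ∧
    (∀ y, φ 0 y = 0 ∧ φ Real.pi y = 0) ∧ (∀ x, φ x 0 = 0 ∧ φ x Real.pi = 0) ∧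
    (∀ x ∈ Icc 0 Real.pi, ∀ y ∈ Icc 0 Real.pi, 0 ≤ φ x y ∧ φ x y ≤ 1) ∧
    rectInt 0 Real.pi (fun x y => 1 - φ x y) ≤ 4 * Real.pi / c ∧
    rectInt 0 Real.pi (d1 φ * d1 φ) ≤ Real.pi * c ∧
    rectInt 0 Real.pi (d2 φ * d2 φ) ≤ Real.pi * c := by
  set ξ : ℝ → ℝ → ℝ := fun x _ => bump c x with hξ
  set η : ℝ → ℝ → ℝ := fun _ y => bump c y with hη
  have sξ : Smooth2 ξ := smooth2_fst (contDiff_bump c)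
  have sη : Smooth2 η := smooth2_snd (contDiff_bump c)
  have s1 : Smooth2 (ξ * η) := sξ.mul sη
  have l1 : ∀ c, Smooth2 (fun x _ => layer c x) := fun c => smooth2_fst (contDiff_layer c)
  have l2 : ∀ c, Smooth2 (fun _ y => layer c y) := fun c => smooth2_snd (contDiff_layer c)
  have hc2 : 0 < 2 * c := by positivity
  have e : c ^ 2 * (2 * Real.pi / (2 * c)) = Real.pi * c := by field_simp
  refine ⟨ξ * η, s1, fun y => ?_, fun x => ?_, fun x hx y hy => ?_, ?_, ?_, ?_⟩
  · simp [hξ, bump_zero, bump_pi]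
  · simp [hη, bump_zero, bump_pi]
  · obtain ⟨a1, a2, -⟩ := bump_bounds hc hx
    obtain ⟨b1, b2, -⟩ := bump_bounds hc hy
    exact ⟨mul_nonneg a1 b1, mul_le_one₀ a2 b1 b2⟩
  · calc _ ≤ rectInt 0 Real.pi ((fun x _ => layer c x) + fun _ y => layer c y) := by
          refine rectInt_mono ((smooth2_const 1).sub s1) ((l1 c).add (l2 c)) fun x hx y hy => ?_
          obtain ⟨a1, a2, a3, -⟩ := bump_bounds hc hx
          obtain ⟨b1, b2, b3, -⟩ := bump_bounds hc hy
          simp only [Pi.mul_apply, Pi.add_apply, hξ, hη]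
          nlinarith
      _ ≤ _ := by
          rw [rectInt_add (l1 c) (l2 c)]
          have := rectInt_layer_le hc
          have e : 4 * Real.pi / c = 2 * Real.pi / c + 2 * Real.pi / c := by ring
          rw [e]
          linarith [this.1, this.2]
  · calc _ ≤ rectInt 0 Real.pi (fun x _ => c ^ 2 * layer (2 * c) x) := by
          refine rectInt_mono (s1.d1.mul s1.d1) ((smooth2_const (c ^ 2)).mul (l1 (2 * c)))
            fun x hx y hy => ?_
          obtain ⟨-, -, -, a4⟩ := bump_bounds hc hx
          obtain ⟨b1, b2, -⟩ := bump_bounds hc hy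
          simp only [Pi.mul_apply]
          rw [sξ.d1_mul sη x hy, hξ, hη, d1_fun (hasDerivAt_bump c x), d1_const_fun]
          have hb : bump c y * bump c y ≤ 1 := mul_le_one₀ b2 b1 b2
          nlinarith [sq_nonneg (bumpDeriv c x), mul_self_nonneg (bump c y),
            mul_le_mul_of_nonneg_left hb (sq_nonneg (bumpDeriv c x))]
      _ ≤ _ := by
          rw [rectInt_const_mul (c ^ 2) (f := fun x _ => layer (2 * c) x), ← e]
          exact mul_le_mul_of_nonneg_left (rectInt_layer_le hc2).1 (sq_nonneg c)
  · calc _ ≤ rectInt 0 Real.pi (fun _ y => c ^ 2 * layer (2 * c) y) := by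
          refine rectInt_mono (s1.d2.mul s1.d2) ((smooth2_const (c ^ 2)).mul (l2 (2 * c)))
            fun x hx y hy => ?_
          obtain ⟨b1, b2, -⟩ := bump_bounds hc hx
          obtain ⟨-, -, -, a4⟩ := bump_bounds hc hy
          simp only [Pi.mul_apply]
          rw [sξ.d2_mul sη x hy, hξ, hη, d2_fun (hasDerivAt_bump c y) hy, d2_const_fun]
          have hb : bump c x * bump c x ≤ 1 := mul_le_one₀ b2 b1 b2
          nlinarith [sq_nonneg (bumpDeriv c y), mul_self_nonneg (bump c x),
            mul_le_mul_of_nonneg_left hb (sq_nonneg (bumpDeriv c y))]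
      _ ≤ _ := by
          rw [rectInt_const_mul (c ^ 2) (f := fun _ y => layer (2 * c) y), ← e]
          exact mul_le_mul_of_nonneg_left (rectInt_layer_le hc2).2 (sq_nonneg c)

/-! ### Lower bounds in terms of the circulation -/

variable {ω u₁ u₂ : ℝ → ℝ → ℝ}

/-- A vorticity with circulation `m` and velocity bounded in `L²` has a large `L^p` norm. -/
theorem ofReal_half_circulation_le (h₁ : Smooth2 u₁) (h₂ : Smooth2 u₂) (hω : Smooth2 ω)
    (hc : ∀ x, ∀ y ∈ Icc 0 Real.pi, ω x y = d1 u₂ x y - d2 u₁ x y) {m B : ℝ} (hm : 0 < m)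
    (hB : 0 < B) (hE : rectInt 0 Real.pi (u₁ * u₁ + u₂ * u₂) ≤ B) (hA : m ≤ rectInt 0 Real.pi ω)
    {p : ENNReal} (hp : 1 ≤ p) :
    ENNReal.ofReal (m / 2) ≤ ENNReal.ofReal (32 * Real.pi ^ 2 * B / m ^ 2) ^ (1 - (p⁻¹).toReal)
      * eLpNorm (fun z : ℝ × ℝ => ω z.1 z.2) p (volume.restrict (rect 0 Real.pi)) := by
  have hpi := Real.pi_pos
  -- With this `c` and the Young parameter `ε` below, the energy term and the gradient term are each
  -- `m / 4`.
  set c := m ^ 2 / (8 * Real.pi * B) with hcdef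
  have hc0 : 0 < c := by positivity
  obtain ⟨φ, sφ, hφx, hφy, b01, i0, i1, i2⟩ := exists_cutoff hc0
  have sχ : Smooth2 (fun x y => 1 - φ x y) := (smooth2_const 1).sub sφ
  set ε := m / (2 * B) with hε
  have hε0 : 0 < ε := by positivity
  have sE := (h₁.mul h₁).add (h₂.mul h₂)
  have sG := (sφ.d1.mul sφ.d1).add (sφ.d2.mul sφ.d2)
  -- Since `φ` vanishes on the boundary of the square, `∫ φ ω = ∫ (u₁ ∂₂φ - u₂ ∂₁φ)`; Young's
  -- inequality then uses only the `L²` bound on `u`.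
  have inner : rectInt 0 Real.pi (φ * ω) ≤ m / 2 := by
    rw [rectInt_eq_of_div hpi.le ((h₁.mul sφ.d2).sub (h₂.mul sφ.d1)) (sφ.mul h₂) (sφ.mul h₁).neg
      (fun y _ => by simp [(hφx y).1, (hφx y).2]) (fun x _ => by simp [(hφy x).1, (hφy x).2])
      fun x _ y hy => ?_]
    · calc _ ≤ rectInt 0 Real.pi ((fun x y => ε / 2 * (u₁ * u₁ + u₂ * u₂) x y)
            + fun x y => (2 * ε)⁻¹ * (d1 φ * d1 φ + d2 φ * d2 φ) x y) := by
            refine rectInt_mono ((h₁.mul sφ.d2).sub (h₂.mul sφ.d1))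
              (((smooth2_const _).mul sE).add ((smooth2_const _).mul sG)) fun x hx y hy => ?_
            simp only [Pi.mul_apply, Pi.add_apply, Pi.sub_apply]
            have q1 := sq_nonneg (ε * u₁ x y - d2 φ x y)
            have q2 := sq_nonneg (ε * u₂ x y + d1 φ x y)
            have : ε / 2 * (u₁ x y * u₁ x y + u₂ x y * u₂ x y)
                + (2 * ε)⁻¹ * (d1 φ x y * d1 φ x y + d2 φ x y * d2 φ x y)
                - (u₁ x y * d2 φ x y - u₂ x y * d1 φ x y)
                = (2 * ε)⁻¹ * ((ε * u₁ x y - d2 φ x y) ^ 2 + (ε * u₂ x y + d1 φ x y) ^ 2) := by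
              field_simp; ring
            have : 0 ≤ (2 * ε)⁻¹ * ((ε * u₁ x y - d2 φ x y) ^ 2
              + (ε * u₂ x y + d1 φ x y) ^ 2) := by positivity
            linarith
        _ ≤ ε / 2 * B + (2 * ε)⁻¹ * (Real.pi * c + Real.pi * c) := by
            rw [rectInt_add (f := fun x y => ε / 2 * (u₁ * u₁ + u₂ * u₂) x y)
              (g := fun x y => (2 * ε)⁻¹ * (d1 φ * d1 φ + d2 φ * d2 φ) x y) ((smooth2_const _).mul sE) ((smooth2_const _).mul sG), rectInt_const_mul,
              rectInt_const_mul, rectInt_add (sφ.d1.mul sφ.d1) (sφ.d2.mul sφ.d2)]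
            gcongr
        _ = m / 2 := by rw [hε, hcdef]; field_simp; ring
    · rw [sφ.d1_mul h₂ x hy, d2_neg, sφ.d2_mul h₁ x hy]
      simp only [Pi.mul_apply, Pi.sub_apply, hc x y hy]; ring
  have outer : m / 2 ≤ ∫ z in rect 0 Real.pi, (1 - φ z.1 z.2) * ω z.1 z.2 := by
    have : rectInt 0 Real.pi ω = rectInt 0 Real.pi (φ * ω)
        + rectInt 0 Real.pi ((fun x y => 1 - φ x y) * ω) := by
      rw [← rectInt_add (sφ.mul hω) (sχ.mul hω)]
      exact rectInt_congr fun x _ y _ => by simp only [Pi.add_apply, Pi.mul_apply]; ring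
    change m / 2 ≤ rectInt 0 Real.pi ((fun x y => 1 - φ x y) * ω)
    linarith
  have hrect := ae_restrict_mem (μ := volume) (measurableSet_rect 0 Real.pi)
  have holder := ofReal_integral_mul_le (μ := volume.restrict (rect 0 Real.pi))
    (f := fun z => ω z.1 z.2) (χ := fun z => 1 - φ z.1 z.2) (hω.integrableOn 0 Real.pi).1
    (by filter_upwards [hrect] with z hz; linarith [(b01 z.1 hz.1 z.2 hz.2).2])
    (by filter_upwards [hrect] with z hz; linarith [(b01 z.1 hz.1 z.2 hz.2).1])
    (sχ.integrableOn 0 Real.pi) i0 hp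
  have e : 4 * Real.pi / c = 32 * Real.pi ^ 2 * B / m ^ 2 := by rw [hcdef]; field_simp; ring
  rw [e] at holder
  exact (ENNReal.ofReal_le_ofReal outer).trans holder

/-- The circulation around `[0, π] × [0, π]` bounds the velocity from below. -/
theorem ofReal_circulation_le (h₁ : Smooth2 u₁) (h₂ : Smooth2 u₂)
    (hc : ∀ x, ∀ y ∈ Icc 0 Real.pi, ω x y = d1 u₂ x y - d2 u₁ x y) {m : ℝ}
    (hA : 4 * Real.pi * m ≤ rectInt 0 Real.pi ω) :
    ENNReal.ofReal m ≤ stripLpNorm ⊤ (vecLength u₁ u₂) := by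
  have hpi := Real.pi_pos
  set N := stripLpNorm ⊤ (vecLength u₁ u₂)
  rcases eq_or_ne N ⊤ with h | h
  · rw [h]; exact le_top
  rw [ENNReal.ofReal_le_iff_le_toReal h]
  have b : ∀ x ∈ Icc 0 Real.pi, ∀ y ∈ Icc 0 Real.pi,
      |u₁ x y| ≤ N.toReal ∧ |u₂ x y| ≤ N.toReal := fun x hx y hy => by
    have := abs_le_stripLpNorm_vecLength h₁ h₂ hx hy
    exact ⟨(ENNReal.ofReal_le_iff_le_toReal h).1 this.1,
      (ENNReal.ofReal_le_iff_le_toReal h).1 this.2⟩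
  -- Each pair of opposite sides contributes at most `π · 2N`, hence `4 π N` in total.
  have aux : ∀ f : ℝ → ℝ, ContinuousOn f (Icc 0 Real.pi) →
      (∀ s ∈ Icc 0 Real.pi, f s ≤ 2 * N.toReal) →
      ∫ s in Icc 0 Real.pi, f s ≤ Real.pi * (2 * N.toReal) := fun f hf hb => by
    have := setIntegral_mono_on (hf.integrableOn_compact isCompact_Icc)
      (integrableOn_const (μ := volume) (by simp)) measurableSet_Icc hb
    rw [setIntegral_const] at this
    simpa [hpi.le] using this
  have i1 := aux (fun y => u₂ Real.pi y - u₂ 0 y)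
    ((h₂.continuousOn_snd _).sub (h₂.continuousOn_snd _)) fun y hy => by
      linarith [(abs_le.1 (b _ pi_mem_Icc_pi y hy).2).2, (abs_le.1 (b _ zero_mem_Icc_pi y hy).2).1]
  have i2 := aux (fun x => -(u₁ x Real.pi - u₁ x 0))
    ((h₁.continuousOn_fst pi_mem_Icc_pi _).sub (h₁.continuousOn_fst zero_mem_Icc_pi _)).neg
    fun x hx => by
      linarith [(abs_le.1 (b x hx _ pi_mem_Icc_pi).1).1, (abs_le.1 (b x hx _ zero_mem_Icc_pi).1).2]
  rw [rectInt_congr (g := d1 u₂ - d2 u₁) fun x _ y hy => hc x y hy, rectInt_sub h₂.d1 h₁.d2,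
    rectInt_d1 hpi.le h₂, rectInt_d2 h₁] at hA
  rw [integral_neg] at i2
  have : 4 * Real.pi * m ≤ 4 * Real.pi * N.toReal := by linarith
  exact le_of_mul_le_mul_left this (by positivity)

end BoussinesqStrip

/-! ### From linear circulation growth to the final bounds. -/

namespace BoussinesqStrip

variable {T : EReal} {ρ₀ ω₀ : ℝ → ℝ → ℝ}

theorem eLpNorm_rect_le_stripLpNorm (p : ENNReal) (f : ℝ → ℝ → ℝ) :
    eLpNorm (fun z : ℝ × ℝ => f z.1 z.2) p (volume.restrict (rect 0 Real.pi)) ≤ stripLpNorm p f :=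
  eLpNorm_mono_measure _ (Measure.restrict_mono (prod_mono Icc_zero_pi_subset subset_rfl) le_rfl)

/-- The `L^p` norm of the vorticity when the circulation grows linearly in time. -/
theorem ofReal_rpow_le_eLpNorm {ω u₁ u₂ : ℝ → ℝ → ℝ} (h₁ : Smooth2 u₁) (h₂ : Smooth2 u₂)
    (hω : Smooth2 ω) (hc : ∀ x, ∀ y ∈ Icc 0 Real.pi, ω x y = d1 u₂ x y - d2 u₁ x y)
    {a B D t : ℝ} (ha : 0 < a) (hB : 0 < B) (hD : D = 32 * Real.pi ^ 2 * B / a ^ 2) (hD1 : 1 ≤ D)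
    (ht : 0 ≤ t) (hE : rectInt 0 Real.pi (u₁ * u₁ + u₂ * u₂) ≤ B)
    (hA : a * t ≤ rectInt 0 Real.pi ω) {p : ENNReal} (hp : 1 ≤ p) :
    ENNReal.ofReal (a / (2 * D) * t ^ (3 - (2 / p).toReal))
      ≤ eLpNorm (fun z : ℝ × ℝ => ω z.1 z.2) p (volume.restrict (rect 0 Real.pi)) := by
  set N := eLpNorm (fun z : ℝ × ℝ => ω z.1 z.2) p (volume.restrict (rect 0 Real.pi))
  set α := 1 - (p⁻¹).toReal with hα
  have hα0 : 0 ≤ α := by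
    have := ENNReal.toReal_mono (by simp) (ENNReal.inv_le_one.2 hp)
    rw [ENNReal.toReal_one] at this
    linarith
  have hα1 : α ≤ 1 := by linarith [ENNReal.toReal_nonneg (a := p⁻¹)]
  have he : 3 - (2 / p).toReal = 1 + 2 * α := by
    rw [div_eq_mul_inv, ENNReal.toReal_mul, hα]; simp; ring
  have hD0 : 0 < D := by linarith
  rw [he]
  rcases ht.eq_or_lt with rfl | ht
  · rw [Real.zero_rpow (by linarith)]; simp
  rcases eq_or_ne N ⊤ with h | h
  · rw [h]; exact le_top
  have key := ofReal_half_circulation_le h₁ h₂ hω hc (mul_pos ha ht) hB hE hA hp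
  change _ ≤ _ ^ α * N at key
  have e1 : 32 * Real.pi ^ 2 * B / (a * t) ^ 2 = D / t ^ 2 := by rw [hD]; field_simp
  have hq : 0 < D / t ^ 2 := by positivity
  rw [e1, ENNReal.ofReal_rpow_of_pos hq, ← ENNReal.ofReal_toReal h,
    ← ENNReal.ofReal_mul (by positivity), ENNReal.ofReal_le_ofReal_iff
      (mul_nonneg (by positivity) ENNReal.toReal_nonneg)] at key
  rw [ENNReal.ofReal_le_iff_le_toReal h]
  have e2 : (D / t ^ 2) ^ α * t ^ (2 * α) = D ^ α := by
    rw [Real.div_rpow hD0.le (by positivity), Real.rpow_mul ht.le, Real.rpow_two]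
    field_simp
  -- The assumption `1 ≤ D` is used here, so that the constant does not depend on `p`.
  have e3 : D ^ α ≤ D := by
    calc D ^ α ≤ D ^ (1 : ℝ) := Real.rpow_le_rpow_of_exponent_le hD1 hα1
      _ = D := Real.rpow_one D
  rw [Real.rpow_add ht, Real.rpow_one]
  have hs : 0 < t ^ (2 * α) := Real.rpow_pos_of_pos ht _
  have hN := ENNReal.toReal_nonneg (a := N)
  have h3 : a * t / 2 * t ^ (2 * α) ≤ D * N.toReal := by
    calc _ ≤ (D / t ^ 2) ^ α * N.toReal * t ^ (2 * α) := by gcongr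
      _ = D ^ α * N.toReal := by rw [← e2]; ring
      _ ≤ _ := by gcongr
  calc a / (2 * D) * (t * t ^ (2 * α)) = (a * t / 2 * t ^ (2 * α)) / D := by field_simp
    _ ≤ N.toReal := by rw [div_le_iff₀ hD0]; linarith

/-- Here `m` stands for the supremum of `|∇ρ|`. Up to `T₁` the constant bound `k` beats a small
multiple of `t²`; after `T₁` the cubic term absorbs `W`, since `2 W ≤ c t ≤ c t³`, leaving `m ≥ c t²
/ 2`. The constants `c / 4` and `k / 2` make the conclusion strict. -/
theorem exists_quadratic_lower_bound {k c W T₀ : ℝ} (hk : 0 < k) (hc : 0 < c) :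
    ∃ c' : ℝ, 0 < c' ∧ ∀ m t : ℝ, 0 ≤ t → k ≤ m → (T₀ ≤ t → c * t ^ 3 ≤ W + m * t) →
      c' * t ^ 2 < m := by
  set T₁ := max T₀ (max 1 (2 * W / c)) with hT₁
  have h1 : 1 ≤ T₁ := (le_max_left _ _).trans (le_max_right _ _)
  have hW : 2 * W / c ≤ T₁ := (le_max_right _ _).trans (le_max_right _ _)
  have hT : T₀ ≤ T₁ := le_max_left _ _
  refine ⟨min (c / 4) (k / (2 * T₁ ^ 2)), by positivity, fun m t ht hkm h => ?_⟩
  rcases le_total t T₁ with htT | htT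
  · calc _ ≤ k / (2 * T₁ ^ 2) * T₁ ^ 2 := by gcongr; exact min_le_right _ _
      _ = k / 2 := by field_simp
      _ < m := by linarith
  · have ht1 : 1 ≤ t := h1.trans htT
    have h3 := h (hT.trans htT)
    have hWt : 2 * W ≤ c * t := by
      rw [div_le_iff₀ hc] at hW; nlinarith
    have hm : c * t ^ 2 / 2 ≤ m := by
      have h4 : c * t ≤ c * t ^ 3 := by gcongr; exact le_self_pow₀ ht1 (by norm_num)
      have : c * t ^ 2 / 2 * t ≤ m * t := by linarith
      exact le_of_mul_le_mul_right this (by linarith)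
    calc _ ≤ c / 4 * t ^ 2 := by gcongr; exact min_le_left _ _
      _ < c * t ^ 2 / 2 := by nlinarith [mul_pos hc (by positivity : 0 < t ^ 2)]
      _ ≤ m := hm

/-- The initial kinetic energy is determined by the initial vorticity. -/
theorem exists_initial_energy_bound (ρ₀ ω₀ : ℝ → ℝ → ℝ) :
    ∃ U : ℝ, ∀ (T : EReal) (ρ ω u₁ u₂ : ℝ → ℝ → ℝ → ℝ), 0 < T →
      IsSmoothSolution T ρ₀ ω₀ ρ ω u₁ u₂ →
      rectInt 0 Real.pi (u₁ 0 * u₁ 0 + u₂ 0 * u₂ 0) ≤ U := by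
  -- The bound must be chosen before the solution. The velocity of any one solution serves, because
  -- the initial vorticity determines it; without solutions there is nothing to show.
  by_cases hex : ∃ (T : EReal) (ρ ω u₁ u₂ : ℝ → ℝ → ℝ → ℝ), 0 < T ∧
      IsSmoothSolution T ρ₀ ω₀ ρ ω u₁ u₂
  · obtain ⟨T', ρ', ω', v₁, v₂, hT', h'⟩ := hex
    refine ⟨rectInt 0 Real.pi (v₁ 0 * v₁ 0 + v₂ 0 * v₂ 0), fun T ρ ω u₁ u₂ hT h => ?_⟩
    refine (rectInt_congr fun x _ y hy => ?_).le
    obtain ⟨e1, e2⟩ := (h.biot_savart 0 (zero_mem_timeInterval hT)).unique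
      (h'.biot_savart 0 (zero_mem_timeInterval hT'))
      (fun x y hy => by rw [h.initial_vorticity x y hy, h'.initial_vorticity x y hy]) x hy
    simp [e1, e2]
  · exact ⟨0, fun T ρ ω u₁ u₂ hT h => (hex ⟨T, ρ, ω, u₁, u₂, hT, h⟩).elim⟩

theorem le_mul_of_abs_d1_le {f : ℝ → ℝ → ℝ} (hf : Smooth2 f) {y M : ℝ} (hy : y ∈ Icc 0 Real.pi)
    (hM : ∀ x ∈ Icc 0 Real.pi, |d1 f x y| ≤ M) : f 0 y - f Real.pi y ≤ M * Real.pi := by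
  have := Convex.norm_image_sub_le_of_norm_hasDerivWithin_le (f := fun x => f x y)
    (fun x _ => (hf.hasDerivAt x hy).hasDerivWithinAt) hM (convex_Icc 0 Real.pi)
    pi_mem_Icc_pi zero_mem_Icc_pi
  rw [Real.norm_eq_abs, Real.norm_eq_abs, zero_sub, abs_neg, abs_of_pos Real.pi_pos] at this
  exact (le_abs_self _).trans this

end BoussinesqStrip

open BoussinesqStrip in
/-- Growth of smooth solutions of the inviscid Boussinesq equations on `𝕋 × [0, π]`.  The constants
`T₀` and `c` depend only on the initial data.  The bounds are stated for every smooth solution on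
every `[0, T)`, `0 < T ≤ ∞`, in particular for the maximal one, whose `T` is the lifespan. -/
theorem theorem1p3
    (ρ₀ ω₀ : ℝ → ℝ → ℝ)
    (hρ₀ : SmoothOnStrip ρ₀) (hω₀ : SmoothOnStrip ω₀)
    (hρ₀_even : EvenX1 ρ₀) (hω₀_odd : OddX1 ω₀)
    (hρ₀_pos : ∃ k₀ : ℝ, 0 < k₀ ∧ ∀ x₂ ∈ Set.Icc 0 Real.pi, k₀ ≤ ρ₀ 0 x₂)
    (hρ₀_nonpos : ∀ x₂ ∈ Set.Icc 0 Real.pi, ρ₀ Real.pi x₂ ≤ 0) :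
    ∃ T₀ c : ℝ, 0 ≤ T₀ ∧ 0 < c ∧
      (0 ≤ (∫ x in Set.Icc 0 Real.pi ×ˢ Set.Icc 0 Real.pi, ω₀ x.1 x.2) → T₀ = 0) ∧
      ∀ (T : EReal) (ρ ω u₁ u₂ : ℝ → ℝ → ℝ → ℝ),
        0 < T → IsSmoothSolution T ρ₀ ω₀ ρ ω u₁ u₂ →
        (∀ p : ENNReal, 1 ≤ p → ∀ t : ℝ, T₀ ≤ t → (t : EReal) < T →
          ENNReal.ofReal (c * t ^ (3 - (2 / p).toReal)) ≤ stripLpNorm p (ω t)) ∧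
        (∀ t : ℝ, T₀ ≤ t → (t : EReal) < T →
          ENNReal.ofReal (c * t) ≤ stripLpNorm ⊤ (vecLength (u₁ t) (u₂ t))) ∧
        (∀ t : ℝ, 0 ≤ t → (t : EReal) < T →
          ENNReal.ofReal (c * t ^ 2) <
            ⨆ τ ∈ Set.Icc 0 t, stripLpNorm ⊤ (vecLength (d1 (ρ τ)) (d2 (ρ τ)))) := by
  obtain ⟨k₀, hk₀, hkρ⟩ := hρ₀_pos
  have hpi := Real.pi_pos
  obtain ⟨R, hR⟩ := hρ₀.smooth2.exists_bound 0 Real.pi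
  obtain ⟨W, hW⟩ := hω₀.smooth2.exists_bound 0 Real.pi
  obtain ⟨U, hU⟩ := exists_initial_energy_bound ρ₀ ω₀
  set A₀ := rectInt 0 Real.pi ω₀ with hA₀
  -- Half the growth rate of the circulation: the other half offsets a negative `A₀` once `t ≥ -A₀ /
  -- a`.
  set a := k₀ * Real.pi / 2 with ha_def
  have ha : 0 < a := by positivity
  set T₀ := max 0 (-A₀ / a) with hT₀
  -- The summand `a ^ 2` is added to ensure `B > 0` and `D ≥ 1`.
  set B := |U| + |4 * Real.pi ^ 3 * R| + a ^ 2 with hB_def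
  have hB : 0 < B := by positivity
  set D := 32 * Real.pi ^ 2 * B / a ^ 2 with hD
  have hD1 : 1 ≤ D := by
    rw [hD, le_div_iff₀ (by positivity), one_mul]
    have h1 : a ^ 2 ≤ B := by
      rw [hB_def]; linarith [abs_nonneg U, abs_nonneg (4 * Real.pi ^ 3 * R)]
    have h2 : 1 ≤ 32 * Real.pi ^ 2 := by nlinarith [Real.pi_gt_three]
    nlinarith
  have hc₁ : 0 < a / (2 * D) := by positivity
  obtain ⟨c₂, hc₂, hquad⟩ := exists_quadratic_lower_bound (W := W) (T₀ := T₀)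
    (div_pos hk₀ hpi) hc₁
  set c := min (a / (2 * D)) (min (a / (4 * Real.pi)) c₂) with hc_def
  have cle₁ : c ≤ a / (2 * D) := min_le_left _ _
  have cle₂ : c ≤ a / (4 * Real.pi) := (min_le_right _ _).trans (min_le_left _ _)
  have cle₃ : c ≤ c₂ := (min_le_right _ _).trans (min_le_right _ _)
  refine ⟨T₀, c, le_max_left _ _, by positivity, fun h => ?_, fun T ρ ω u₁ u₂ hT h => ?_⟩
  · exact max_eq_left (div_nonpos_of_nonpos_of_nonneg (neg_nonpos.2 h) ha.le)
  have hu₁ : ∀ t ∈ timeInterval T, ∀ y ∈ Set.Icc 0 Real.pi, u₁ t 0 y = 0 ∧ u₁ t Real.pi y = 0 :=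
    fun t ht y hy => h.velocity_axes hT hρ₀_even hω₀_odd ht hy
  have hu₁' : ∀ t ∈ timeInterval T, ∀ s ∈ Set.Icc 0 t, ∀ y ∈ Set.Icc 0 Real.pi,
      u₁ s 0 y = 0 ∧ u₁ s Real.pi y = 0 :=
    fun t ht s hs => hu₁ s (Icc_subset_timeInterval ht hs)
  -- Each axis is treated as a degenerate rectangle, on which the maximum principle for `ρ` applies.
  have hgap : ∀ t ∈ timeInterval T, ∀ y ∈ Set.Icc 0 Real.pi, k₀ ≤ ρ t 0 y - ρ t Real.pi y := by
    intro t ht y hy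
    have h1 := h.le_density hT (a := 0) (b := 0) ht
      (fun s hs y hy => ⟨(hu₁' t ht s hs y hy).1, (hu₁' t ht s hs y hy).1⟩)
      (fun x hx y hy => by rw [Set.Icc_self, Set.mem_singleton_iff] at hx; rw [hx]; exact hkρ y hy)
      0 (by simp) y hy
    have h2 := h.density_le hT (a := Real.pi) (b := Real.pi) ht
      (fun s hs y hy => ⟨(hu₁' t ht s hs y hy).2, (hu₁' t ht s hs y hy).2⟩)
      (fun x hx y hy => by
        rw [Set.Icc_self, Set.mem_singleton_iff] at hx; rw [hx]; exact hρ₀_nonpos y hy)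
      Real.pi (by simp) y hy
    linarith
  have hcirc : ∀ t ∈ timeInterval T, T₀ ≤ t → a * t ≤ rectInt 0 Real.pi (ω t) := by
    intro t ht htT
    have h1 := h.rectInt_vorticity_ge hT ht (hu₁' t ht)
      (fun s hs => hgap s (Icc_subset_timeInterval ht hs))
    have h2 : -A₀ / a ≤ t := (le_max_right _ _).trans htT
    rw [div_le_iff₀ ha] at h2
    have h3 : k₀ * Real.pi * t = 2 * (a * t) := by rw [ha_def]; ring
    linarith
  have hmem : ∀ t : ℝ, T₀ ≤ t → (t : EReal) < T → t ∈ timeInterval T :=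
    fun t h1 h2 => ⟨(le_max_left _ _).trans h1, h2⟩
  have hcurl : ∀ t ∈ timeInterval T, ∀ x, ∀ y ∈ Set.Icc 0 Real.pi,
      ω t x y = d1 (u₂ t) x y - d2 (u₁ t) x y := fun t ht x y hy =>
    let ⟨_, hψ⟩ := h.exists_isStream ht
    hψ.curl_eq x y hy
  -- Kept on the square rather than the strip, so that it can be compared with the bound on `|ω|`,
  -- which is available there.
  have hLp : ∀ p : ENNReal, 1 ≤ p → ∀ t : ℝ, T₀ ≤ t → (t : EReal) < T →
      ENNReal.ofReal (a / (2 * D) * t ^ (3 - (2 / p).toReal)) ≤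
        MeasureTheory.eLpNorm (fun z : ℝ × ℝ => ω t z.1 z.2) p
          (MeasureTheory.volume.restrict (rect 0 Real.pi)) := by
    intro p hp t h1 h2
    have ht := hmem t h1 h2
    refine ofReal_rpow_le_eLpNorm (h.flow ht).smooth₁ (h.flow ht).smooth₂
      (Smooth3.slice h.smooth_vorticity.smooth ht) (hcurl t ht) ha hB hD hD1 ht.1 ?_
      (hcirc t ht h1) hp
    have := h.energy_le hT ht (hu₁' t ht) hR
    have := hU T ρ ω u₁ u₂ hT h
    rw [hB_def]
    linarith [le_abs_self U, le_abs_self (4 * Real.pi ^ 3 * R), sq_nonneg a]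
  refine ⟨fun p hp t h1 h2 => ?_, fun t h1 h2 => ?_, fun t h1 h2 => ?_⟩
  · refine le_trans (ENNReal.ofReal_le_ofReal ?_)
      ((hLp p hp t h1 h2).trans (eLpNorm_rect_le_stripLpNorm p (ω t)))
    exact mul_le_mul_of_nonneg_right cle₁ (Real.rpow_nonneg (hmem t h1 h2).1 _)
  · have ht := hmem t h1 h2
    refine ofReal_circulation_le (h.flow ht).smooth₁ (h.flow ht).smooth₂ (hcurl t ht) ?_
    have h3 := mul_le_mul_of_nonneg_right cle₂ ht.1
    calc 4 * Real.pi * (c * t) ≤ 4 * Real.pi * (a / (4 * Real.pi) * t) := by gcongr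
      _ = a * t := by field_simp
      _ ≤ _ := hcirc t ht h1
  · have ht : t ∈ timeInterval T := ⟨h1, h2⟩
    set S := ⨆ τ ∈ Set.Icc 0 t, stripLpNorm ⊤ (vecLength (d1 (ρ τ)) (d2 (ρ τ))) with hS
    -- An infinite supremum makes the strict inequality immediate.
    rcases eq_or_ne S ⊤ with hS' | hS'
    · rw [hS']; exact ENNReal.ofReal_lt_top
    rw [ENNReal.ofReal_lt_iff_lt_toReal (by positivity) hS']
    have hd : ∀ s ∈ Set.Icc 0 t, ∀ x ∈ Set.Icc 0 Real.pi, ∀ y ∈ Set.Icc 0 Real.pi,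
        |d1 (ρ s) x y| ≤ S.toReal := by
      intro s hs x hx y hy
      rw [← ENNReal.ofReal_le_iff_le_toReal hS']
      have sρ : Smooth2 (ρ s) :=
        Smooth3.slice h.smooth_density.smooth (Icc_subset_timeInterval ht hs)
      refine (abs_le_stripLpNorm_vecLength sρ.d1 sρ.d2 hx hy).1.trans ?_
      exact le_iSup₂ (f := fun τ (_ : τ ∈ Set.Icc 0 t) =>
        stripLpNorm ⊤ (vecLength (d1 (ρ τ)) (d2 (ρ τ)))) s hs
    refine lt_of_le_of_lt (mul_le_mul_of_nonneg_right cle₃ (sq_nonneg t))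
      (hquad _ t h1 ?_ fun hTt => ?_)
    · rw [div_le_iff₀ hpi]
      exact (hgap t ht 0 zero_mem_Icc_pi).trans
        (le_mul_of_abs_d1_le (Smooth3.slice h.smooth_density.smooth ht) zero_mem_Icc_pi
          fun x hx => hd t ⟨h1, le_rfl⟩ x hx 0 zero_mem_Icc_pi)
    -- At `p = ∞` the exponent is `3`; the vorticity is also at most `W + S t`, which is the cubic
    -- comparison required.
    · have hb := h.abs_vorticity_le hT ht (hu₁' t ht) hW hd
      have h3 := hLp ⊤ le_top t hTt h2
      have h4 : MeasureTheory.eLpNorm (fun z : ℝ × ℝ => ω t z.1 z.2) ⊤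
          (MeasureTheory.volume.restrict (rect 0 Real.pi)) ≤ ENNReal.ofReal (W + S.toReal * t) := by
        rw [MeasureTheory.eLpNorm_exponent_top]
        refine MeasureTheory.eLpNormEssSup_le_of_ae_bound ?_
        filter_upwards [MeasureTheory.ae_restrict_mem (measurableSet_rect 0 Real.pi)] with z hz
        exact hb z.1 hz.1 z.2 hz.2
      have h5 := h3.trans h4
      have h6 : 0 ≤ W + S.toReal * t :=
        (abs_nonneg _).trans (hb 0 zero_mem_Icc_pi 0 zero_mem_Icc_pi)
      rw [ENNReal.ofReal_le_ofReal_iff h6] at h5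
      simpa using h5
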